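/- Let $K_n$ be the complete graph on $n\ge 3$ vertices. For a set $\mathcal H$ of subgraphs of $K_n$, an edge-coloring $\varphi$ of $K_n$ (any function on the edges) is $\mathcal H$-polychromatic if every graph in $\mathcal H$ contains edges of all the colors used by $\varphi$; $\mathrm{poly}_{\mathcal H}(K_n)$ is the largest number of colors used by an $\mathcal H$-polychromatic coloring, and an $\mathcal H$-polychromatic coloring using that many colors is optimal. Let $R_0$ be the set of all $2$-factors ($2$-regular spanning subgraphs) and $C_0$ the set of all Hamiltonian cycles of $K_n$. An edge-coloring $\varphi$ of a complete graph is simply-ordered if its vertices can be ordered $v_1,\dots,v_N$ so that for all $i<j<m$: $\varphi(v_iv_j)=\varphi(v_iv_m)$; and $\varphi(v_iv_m)=\varphi(v_jv_m)=a$ implies $\varphi(v_tv_m)=a$ for all $i\le t\le j$. For a nonempty vertex set $Z$, an edge-coloring $\varphi$ of $K_n$ is quasi-simply-ordered with respect to $Z$ if (i) for each $v\in Z$ all edges from $v$ to vertices outside $Z$ have the same color; (ii) each $v\in Z$ is incident to precisely $n-2$ edges of one color and to one edge $vu$ of another color $t$, where $u\in Z$ and $u$ is incident to precisely $n-2$ edges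 of color $t$; and (iii) the restriction of $\varphi$ to the vertices outside $Z$ is simply-ordered. Theorem. Let $n\ge 3$. For each $\mathcal H\in\{R_0,C_0\}$ there exists an optimal $\mathcal H$-polychromatic coloring of $K_n$ that can be obtained from a simply-ordered coloring of $K_n$ by recoloring exactly one edge and that is quasi-simply-ordered with respect to some vertex set $Z$ with $|Z|=3$. Moreover $$\mathrm{poly}_{R_0}(K_n)=1+\lfloor\log_2(n+1)\rfloor\quad(n\ge 3),\qquad \mathrm{poly}_{C_0}(K_n)=\Big\lfloor\log_2\frac{8(n-1)}{3}\Big\rfloor\quad(n\ge 4).$$ -/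

import Mathlib

/-! Edge colorings of the complete graph on a finite vertex type `V` are functions from the edges
of `⊤ : SimpleGraph V` to a type of colors: Mathlib's `SimpleGraph.TopEdgeLabeling V K`. -/

namespace Polychromatic

open SimpleGraph

/-- The number of colors that an edge coloring uses. -/
noncomputable def numColors {V K : Type*} (φ : TopEdgeLabeling V K) : ℕ :=
  (Set.range φ).ncard

/-- An edge coloring is `𝓗`-polychromatic if every graph in `𝓗` has, on its edges, all colors that
are present in the complete graph. -/
def IsPolychromatic {V K : Type*} (𝓗 : Set (⊤ : SimpleGraph V).Subgraph)
    (φ : TopEdgeLabeling V K) : Prop :=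
  ∀ H ∈ 𝓗, ∀ c ∈ Set.range φ, ∃ e : (⊤ : SimpleGraph V).edgeSet, (e : Sym2 V) ∈ H.edgeSet ∧ φ e = c

/-- The numbers of colors of the `𝓗`-polychromatic edge colorings. -/
def polyNumbers {V : Type*} (𝓗 : Set (⊤ : SimpleGraph V).Subgraph) : Set ℕ :=
  {k | ∃ φ : TopEdgeLabeling V ℕ, IsPolychromatic 𝓗 φ ∧ numColors φ = k}

/-- The `𝓗`-polychromatic number of the complete graph on `V`: the largest number of colors in an
`𝓗`-polychromatic edge coloring. -/
noncomputable def polyNumber {V : Type*} (𝓗 : Set (⊤ : SimpleGraph V).Subgraph) : ℕ :=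
  sSup (polyNumbers 𝓗)

/-- For a finite vertex set the supremum in `polyNumber` is a maximum. -/
theorem isGreatest_polyNumber {V : Type*} [Finite V] (𝓗 : Set (⊤ : SimpleGraph V).Subgraph)
    (h𝓗 : ∀ H ∈ 𝓗, H.edgeSet.Nonempty) : IsGreatest (polyNumbers 𝓗) (polyNumber 𝓗) := by
  have hb : BddAbove (polyNumbers 𝓗) := by
    refine ⟨Nat.card (⊤ : SimpleGraph V).edgeSet, ?_⟩
    rintro k ⟨φ, -, rfl⟩
    exact Finite.card_range_le φ
  have hn : (polyNumbers 𝓗).Nonempty := by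
    refine ⟨_, (fun _ => 0 : (⊤ : SimpleGraph V).edgeSet → ℕ), ?_, rfl⟩
    rintro H hH c ⟨e, rfl⟩
    obtain ⟨f, hf⟩ := h𝓗 H hH
    exact ⟨⟨f, H.edgeSet_subset hf⟩, hf, rfl⟩
  exact ⟨Nat.sSup_mem hn hb, fun k hk => le_csSup hb hk⟩

/-- An `𝓗`-polychromatic coloring is optimal if the number of its colors is the `𝓗`-polychromatic
number. -/
def IsOptimal {V : Type*} (𝓗 : Set (⊤ : SimpleGraph V).Subgraph)
    (φ : TopEdgeLabeling V ℕ) : Prop :=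
  IsPolychromatic 𝓗 φ ∧ numColors φ = polyNumber 𝓗

/-- `R_q`: the `2`-regular subgraphs of the complete graph on `V` that span at least `|V| - q`
vertices. -/
def twoRegularFamily (V : Type*) (q : ℕ) : Set (⊤ : SimpleGraph V).Subgraph :=
  {H | (∀ v ∈ H.verts, (H.neighborSet v).ncard = 2) ∧ Nat.card V ≤ H.verts.ncard + q}

/-- `C_q`: the cycles of length precisely `|V| - q` in the complete graph on `V`. -/
def cycleFamily (V : Type*) (q : ℕ) : Set (⊤ : SimpleGraph V).Subgraph :=
  {H | ∃ (v : V) (w : (⊤ : SimpleGraph V).Walk v v),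
    w.IsCycle ∧ w.length + q = Nat.card V ∧ w.toSubgraph = H}

/-- Two vertices at different positions of an enumeration are joined by an edge. -/
theorem adj_of_lt {V : Type*} {N : ℕ} (v : Fin N ≃ V) {i j : Fin N} (h : i < j) :
    (⊤ : SimpleGraph V).Adj (v i) (v j) :=
  v.injective.ne h.ne

/-- The coloring is ordered with respect to the vertex ordering `v`. -/
def IsOrderedWith {V K : Type*} (φ : TopEdgeLabeling V K) {N : ℕ} (v : Fin N ≃ V) : Prop :=
  ∀ (i j m : Fin N) (hij : i < j) (hjm : j < m),
    φ.get (v i) (v j) (adj_of_lt v hij) = φ.get (v i) (v m) (adj_of_lt v (hij.trans hjm))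

/-- The coloring is simply-ordered: for some ordering `v₁, …, v_N` of the vertices it is ordered,
and `φ(v_i v_m) = φ(v_j v_m) = a` with `i < j < m` implies `φ(v_t v_m) = a` for `i ≤ t ≤ j`. -/
def IsSimplyOrdered {V K : Type*} (φ : TopEdgeLabeling V K) : Prop :=
  ∃ (N : ℕ) (v : Fin N ≃ V), IsOrderedWith φ v ∧
    ∀ (i j m : Fin N) (hij : i < j) (hjm : j < m),
      φ.get (v i) (v m) (adj_of_lt v (hij.trans hjm)) = φ.get (v j) (v m) (adj_of_lt v hjm) →
      ∀ (t : Fin N) (_ : i ≤ t) (htj : t ≤ j),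
        φ.get (v t) (v m) (adj_of_lt v (htj.trans_lt hjm)) =
          φ.get (v i) (v m) (adj_of_lt v (hij.trans hjm))

/-- The restriction of an edge coloring to the complete graph on the vertices outside `Z`. -/
def restrictCompl {V K : Type*} (φ : TopEdgeLabeling V K) (Z : Finset V) :
    TopEdgeLabeling {x : V // x ∉ Z} K :=
  TopEdgeLabeling.pullback φ (Function.Embedding.subtype fun x => x ∉ Z)

/-- The number of edges of color `c` at the vertex `v`. -/
noncomputable def colorDegree {V K : Type*} (φ : TopEdgeLabeling V K) (v : V) (c : K) : ℕ :=
  {u : V | ∃ h : (⊤ : SimpleGraph V).Adj v u, φ.get v u h = c}.ncard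

/-- The coloring is `Z`-constant: the edges from a vertex of `Z` to the vertices outside `Z` all
have the same color. -/
def IsConstantOn {V K : Type*} (φ : TopEdgeLabeling V K) (Z : Finset V) : Prop :=
  ∀ v ∈ Z, ∀ u ∉ Z, ∀ w ∉ Z, ∀ (hu : (⊤ : SimpleGraph V).Adj v u) (hw : (⊤ : SimpleGraph V).Adj v w),
    φ.get v u hu = φ.get v w hw

/-- The coloring is `Z`-quasi-ordered: `Z` is nonempty, the coloring is `Z`-constant, and each
vertex `v` in `Z` is incident to precisely `n - 2` edges of one color `a` and to one edge `vu` of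
another color `t`, where `u ∈ Z` and `u` is incident to precisely `n - 2` edges of color `t`. -/
def IsQuasiOrdered {V K : Type*} (φ : TopEdgeLabeling V K) (Z : Finset V) : Prop :=
  Z.Nonempty ∧ IsConstantOn φ Z ∧
    ∀ v ∈ Z, ∃ a : K, colorDegree φ v a + 2 = Nat.card V ∧
      ∃ u ∈ Z, ∃ h : (⊤ : SimpleGraph V).Adj v u,
        φ.get v u h ≠ a ∧ colorDegree φ u (φ.get v u h) + 2 = Nat.card V

/-- The coloring is quasi-simply-ordered with respect to `Z`: it is `Z`-quasi-ordered and its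
restriction to the vertices outside `Z` is simply-ordered. -/
def IsQuasiSimplyOrdered {V K : Type*} (φ : TopEdgeLabeling V K) (Z : Finset V) : Prop :=
  IsQuasiOrdered φ Z ∧ IsSimplyOrdered (restrictCompl φ Z)

/-- `φ` is obtained from `ψ` by recoloring one edge: they differ on exactly one edge. -/
def IsOneEdgeRecoloring {V K : Type*} (ψ φ : TopEdgeLabeling V K) : Prop :=
  ∃! e : (⊤ : SimpleGraph V).edgeSet, φ e ≠ ψ e

end Polychromatic

/-! Upper bounds. If a coloring is polychromatic and uses the color a, then the graph of the edges
of other colors (`offGraph φ a`) contains no Hamiltonian cycle, respectively no 2-factor. A degree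
theorem then yields some D with 2D + 1 ≤ n and at least D vertices whose degree in that graph is at
most D. For cycles this is the Pósa–Chvátal condition
(`exists_low_degrees_of_not_hasHamiltonianCycle`). For 2-factors it comes from Tutte's theorem
applied to a gadget graph, and it supplies in addition D + 1 vertices of degree at most D + 1
(`exists_low_degrees_of_not_hasTwoFactor`).

So every color a owns a class of vertices at which almost all edges have color a. With at least four
colors, classes of D vertices belonging to different colors are disjoint. An edge between the
classes of a and b has a color other than a or a color other than b, so counting the edges between
classes (`sq_sum_card_le`) gives (∑ d)² ≤ 3 ∑ d² over every set of colors. For 2-factors, with x = D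
+ 1, it gives (∑ x)² ≤ ∑ (3x² - 2x + 2). Once sorted, such a sequence ends at least as high as 1, 1,
1, 3, 6, 12, …, respectively 1, 1, 1, 4, 8, 16, … (`three_mul_two_pow_le`, `two_pow_le`). Since the
largest D is below n/2, this bounds the number of colors. In the 2-factor case the larger classes
may overlap when two colors have D close to n/2; that case is finite in nature and is settled
separately (`two_pow_le_of_big`).

Lower bounds. Cut the ordered vertices into intervals with the extremal lengths above, and color
each edge by the interval of its earlier end; then recolor the edge from 0 to 2 so that each of the
vertices 0, 1, 2 has just one edge not of its own color. A 2-regular spanning graph that misses a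
later color c must send both edges of every vertex of interval c to earlier vertices, which is
impossible if the interval is longer than what precedes it. For Hamiltonian cycles equal length is
harmless too, because it would split off a union of components. -/

namespace Polychromatic

/-! ### Growth of integer sequences under quadratic constraints -/

/-- A convex quadratic that is negative at `a` and nonpositive at `b` is negative on `[a, b)`. -/
theorem chord_neg {p d a b y : ℤ} (ha : 2 * a ^ 2 - 2 * p * a + d < 0)
    (hb : 2 * b ^ 2 - 2 * p * b + d ≤ 0) (hay : a ≤ y) (hyb : y < b) :
    2 * y ^ 2 - 2 * p * y + d < 0 := by
  have hab : 0 < b - a := by omega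
  by_contra h
  push Not at h
  have h1 : (b - a) * (2 * y ^ 2 - 2 * p * y + d) =
      (b - y) * (2 * a ^ 2 - 2 * p * a + d) + (y - a) * (2 * b ^ 2 - 2 * p * b + d)
        - 2 * (b - a) * ((y - a) * (b - y)) := by ring
  have h2 : (b - y) * (2 * a ^ 2 - 2 * p * a + d) < 0 :=
    mul_neg_of_pos_of_neg (by omega) ha
  have h3 : (y - a) * (2 * b ^ 2 - 2 * p * b + d) ≤ 0 :=
    mul_nonpos_of_nonneg_of_nonpos (by omega) hb
  have h4 : 0 ≤ 2 * (b - a) * ((y - a) * (b - y)) :=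
    mul_nonneg (by omega) (mul_nonneg (by omega) (by omega))
  have h5 : 0 ≤ (b - a) * (2 * y ^ 2 - 2 * p * y + d) := mul_nonneg hab.le h
  linarith

/-- `f(T) ≤ 0`, and `f < 0` from `x` up to `T`. -/
def SlowState (p d x T : ℤ) : Prop :=
  2 * T ^ 2 - 2 * p * T + d ≤ 0 ∧ ∀ y, x ≤ y → 0 ≤ 2 * y ^ 2 - 2 * p * y + d → T ≤ y

/-- Appending y replaces p by p + y and d by the value of the quadratic at y. As d ≤ 2pT - 2T², the
new quadratic at 2T is at most a convex function of y that equals 4T(T - p) at y = T and 6T(T - p)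
at y = 2T. Both are nonpositive, because the value at T is nonpositive while d ≥ 0 forces T ≤ p. The
new quadratic is also negative at y, and convexity covers what lies between. -/
theorem slow_slow {p d x y T : ℤ} (hT : 0 < T) (hp : 0 < p) (hd : 0 ≤ d)
    (h : SlowState p d x T) (hxy : x ≤ y) (hy : 0 ≤ 2 * y ^ 2 - 2 * p * y + d) (hyT : y < 2 * T) :
    SlowState (p + y) (2 * y ^ 2 - 2 * p * y + d) y (2 * T) := by
  obtain ⟨h1, h2⟩ := h
  have hTy := h2 y hxy hy
  have hchord : 0 ≤ (y - T) * (2 * T - y) := mul_nonneg (by omega) (by omega)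
  have hTp : T ≤ p := by nlinarith
  have hpT : 0 ≤ (p - T) * (y - T) := mul_nonneg (by omega) (by omega)
  have hpT' : 0 ≤ (p - T) * (2 * T - y) := mul_nonneg (by omega) (by omega)
  have h3 : 2 * (2 * T) ^ 2 - 2 * (p + y) * (2 * T) + (2 * y ^ 2 - 2 * p * y + d) ≤ 0 := by
    nlinarith [mul_nonneg hT.le (sub_nonneg.2 hTp), mul_nonneg hT.le (sub_nonneg.2 hTy)]
  refine ⟨h3, fun z hz hfz => ?_⟩
  by_contra hlt
  have h4 : 2 * y ^ 2 - 2 * (p + y) * y + (2 * y ^ 2 - 2 * p * y + d) < 0 := by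
    nlinarith [mul_nonneg hT.le (sub_nonneg.2 hTp), mul_nonneg hT.le (sub_nonneg.2 hTy), mul_pos hT hp,
      mul_pos hp (show 0 < 2 * T - y by omega)]
  exact absurd hfz (not_le.2 (chord_neg h4 h3 hz (by omega)))

/-- P and D are the sum and the slack before the last two terms x and y. A large term x followed by
y < 2T puts the sequence back under the control of the quadratic, with threshold 2T. -/
theorem fast_slow {P D x y T : ℤ} (hT : 0 < T) (hP : 0 < P) (hTP : T ≤ 2 * P) (hD : D ≤ 2 * P * x)
    (hx : T ≤ x) (hxy : x ≤ y) (hyT : y < 2 * T) :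
    SlowState (P + x + y) (2 * y ^ 2 - 2 * (P + x) * y + (2 * x ^ 2 - 2 * P * x + D)) y (2 * T) := by
  have a1 : 0 ≤ (x - T) * (2 * T - x) := mul_nonneg (by omega) (by omega)
  have a2 : 0 ≤ (y - T) * (2 * T - y) := mul_nonneg (by omega) (by omega)
  have a3 : 0 ≤ (x - T) * (2 * T - y) := mul_nonneg (by omega) (by omega)
  have a4 : 0 ≤ (y - x) * (2 * T - y) := mul_nonneg (by omega) (by omega)
  have a5 : 0 ≤ (y - x) * (x - T) := mul_nonneg (by omega) (by omega)
  have b1 : 0 ≤ P * (x - T) := mul_nonneg hP.le (by omega)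
  have b2 : 0 ≤ P * (y - x) := mul_nonneg hP.le (by omega)
  have b3 : 0 ≤ T * (2 * P - T) := mul_nonneg hT.le (by omega)
  have b4 : 0 < P * T := mul_pos hP hT
  have h3 : 2 * (2 * T) ^ 2 - 2 * (P + x + y) * (2 * T) +
      (2 * y ^ 2 - 2 * (P + x) * y + (2 * x ^ 2 - 2 * P * x + D)) ≤ 0 := by nlinarith
  refine ⟨h3, fun z hz hfz => ?_⟩
  by_contra hlt
  have h4 : 2 * y ^ 2 - 2 * (P + x + y) * y +
      (2 * y ^ 2 - 2 * (P + x) * y + (2 * x ^ 2 - 2 * P * x + D)) < 0 := by nlinarith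
  exact absurd hfz (not_le.2 (chord_neg h4 h3 hz (by omega)))

theorem sum_sq_le_sum_mul {k : ℕ} {x : ℕ → ℤ} (hpos : ∀ i < k, 0 < x i)
    (hmono : ∀ i j, i ≤ j → j < k → x i ≤ x j) {j : ℕ} (hj : j < k) :
    ∑ i ∈ Finset.range j, x i ^ 2 ≤ (∑ i ∈ Finset.range j, x i) * x j := by
  rw [Finset.sum_mul]
  refine Finset.sum_le_sum fun i hi => ?_
  have hi := Finset.mem_range.1 hi
  nlinarith [hpos i (hi.trans hj), hmono i j hi.le hj]

theorem sum_sq_le_sq_sum {k : ℕ} {x : ℕ → ℤ} (hpos : ∀ i < k, 0 < x i) {j : ℕ} (hj : j ≤ k) :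
    ∑ i ∈ Finset.range j, x i ^ 2 ≤ (∑ i ∈ Finset.range j, x i) ^ 2 :=
  Finset.sum_sq_le_sq_sum_of_nonneg fun i hi => (hpos i (by grind)).le

/-- Growth of a monotone sequence all of whose initial segments satisfy `(∑ x)² ≤ 3 ∑ x²`. -/
theorem three_mul_two_pow_le {k : ℕ} {x : ℕ → ℤ} (hpos : ∀ i < k, 0 < x i)
    (hmono : ∀ i j, i ≤ j → j < k → x i ≤ x j)
    (hsum : ∀ j ≤ k, (∑ i ∈ Finset.range j, x i) ^ 2 ≤ 3 * ∑ i ∈ Finset.range j, x i ^ 2)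
    (hk : 4 ≤ k) : 3 * 2 ^ (k - 4) ≤ x (k - 1) := by
  -- With sum p and slack d = 3∑x² - p², the hypothesis for one more term y reads 0 ≤ 2y² - 2py + d,
  -- and the right side is the new slack. Either this quadratic forces the next term up to 3 · 2^j,
  -- or the current term is already that large.
  have key : ∀ j, j + 3 < k →
      SlowState (∑ i ∈ Finset.range (j + 3), x i)
        (3 * ∑ i ∈ Finset.range (j + 3), x i ^ 2 - (∑ i ∈ Finset.range (j + 3), x i) ^ 2)
        (x (j + 2)) (3 * 2 ^ j) ∨
      (3 * 2 ^ j ≤ x (j + 2) ∧ 3 * 2 ^ j ≤ 2 * ∑ i ∈ Finset.range (j + 2), x i) := by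
    intro j
    induction j with
    | zero =>
      intro h
      simp only [Finset.sum_range_succ, Finset.sum_range_zero, zero_add, pow_zero, mul_one]
      have h0 := hpos 0 (by omega)
      have h01 := hmono 0 1 (by omega) (by omega)
      have h12 := hmono 1 2 (by omega) (by omega)
      by_cases hc : 3 ≤ x 2
      · by_cases hab : 3 ≤ 2 * (x 0 + x 1)
        · exact Or.inr ⟨hc, hab⟩
        · omega
      · left
        have e0 : x 0 = 1 ∨ x 0 = 2 := by omega
        have e1 : x 1 = 1 ∨ x 1 = 2 := by omega
        have e2 : x 2 = 1 ∨ x 2 = 2 := by omega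
        refine ⟨?_, fun y hy hf => ?_⟩
        · rcases e0 with e0 | e0 <;> rcases e1 with e1 | e1 <;> rcases e2 with e2 | e2 <;>
            rw [e0, e1, e2] <;> norm_num
        · by_contra hlt
          have e3 : y = 1 ∨ y = 2 := by omega
          rcases e0 with e0 | e0 <;> rcases e1 with e1 | e1 <;> rcases e2 with e2 | e2 <;>
            rcases e3 with e3 | e3 <;>
            rw [e0, e1, e2, e3] at hf <;> norm_num at hf
    | succ j ih =>
      intro h
      have ih := ih (by omega)
      have hxy := hmono (j + 2) (j + 3) (by omega) (by omega)
      have hx := hpos (j + 2) (by omega)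
      have hs := hsum (j + 3) (by omega)
      have hs' := hsum (j + 4) (by omega)
      have hT : (0 : ℤ) < 3 * 2 ^ j := by positivity
      have hTT : (3 * 2 ^ (j + 1) : ℤ) = 2 * (3 * 2 ^ j) := by ring
      rw [hTT]
      have hP : 0 < ∑ i ∈ Finset.range (j + 2), x i :=
        Finset.sum_pos (fun i hi => hpos i (by grind)) ⟨0, by simp⟩
      have hbound : 3 * ∑ i ∈ Finset.range (j + 2), x i ^ 2 - (∑ i ∈ Finset.range (j + 2), x i) ^ 2
          ≤ 2 * (∑ i ∈ Finset.range (j + 2), x i) * x (j + 2) := by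
        have := sum_sq_le_sum_mul hpos hmono (show j + 2 < k by omega)
        have := sum_sq_le_sq_sum hpos (show j + 2 ≤ k by omega)
        linarith
      rw [Finset.sum_range_succ _ (j + 3), Finset.sum_range_succ _ (j + 3)] at hs'
      rw [show j + 1 + 3 = j + 3 + 1 by ring, show j + 1 + 2 = j + 2 + 1 by ring,
        Finset.sum_range_succ _ (j + 3), Finset.sum_range_succ _ (j + 3)]
      by_cases hlt : x (j + 3) < 2 * (3 * 2 ^ j)
      · left
        rcases ih with ih | ⟨ih1, ih2⟩
        · have := slow_slow hT
            (by rw [Finset.sum_range_succ]; linarith) (by linarith) ih hxy (by linarith) hlt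
          convert this using 1
          ring
        · have := fast_slow hT hP ih2 hbound ih1 hxy hlt
          rw [Finset.sum_range_succ _ (j + 2), Finset.sum_range_succ _ (j + 2)]
          convert this using 1
          ring
      · right
        refine ⟨by simpa using hlt, ?_⟩
        rcases ih with ih | ⟨ih1, ih2⟩
        · have hd : 0 ≤ 3 * ∑ i ∈ Finset.range (j + 3), x i ^ 2 -
            (∑ i ∈ Finset.range (j + 3), x i) ^ 2 := by linarith
          have h1 := ih.1
          rw [show j + 2 + 1 = j + 3 by ring]
          nlinarith
        · rw [Finset.sum_range_succ]
          linarith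
  obtain ⟨j, rfl⟩ : ∃ j, k = j + 4 := ⟨k - 4, by omega⟩
  have hs' := hsum (j + 4) le_rfl
  rw [Finset.sum_range_succ _ (j + 3), Finset.sum_range_succ _ (j + 3)] at hs'
  have hxy := hmono (j + 2) (j + 3) (by omega) (by omega)
  simp only [show j + 4 - 4 = j by omega, show j + 4 - 1 = j + 3 by omega]
  rcases key j (by omega) with h | h
  · exact h.2 _ hxy (by linarith)
  · linarith [h.1]

/-- `SlowState` for the recursion whose increments are `3x² - 2x + 2`. -/
def SlowState' (p d x T : ℤ) : Prop :=
  2 * (T - 1) ^ 2 - 2 * (p + 1) * (T - 1) + (d + 2) < 0 ∧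
    ∀ y, x ≤ y → 0 ≤ 2 * y ^ 2 - 2 * (p + 1) * y + (d + 2) → T ≤ y

/-- On the extremal sequence 1, 1, 1, 4, 8, … the quadratic is positive at the threshold (it is 2 at
T = 4), so the invariant records a negative value at T - 1 instead. Integrality then gives the same
bound on the next term. -/
theorem slow_slow' {p d x y T : ℤ} (hT : 2 ≤ T) (hd : 0 ≤ d)
    (h : SlowState' p d x T) (hxy : x ≤ y) (hy : 0 ≤ 2 * y ^ 2 - 2 * (p + 1) * y + (d + 2))
    (hyT : y < 2 * T) :
    SlowState' (p + y) (2 * y ^ 2 - 2 * (p + 1) * y + (d + 2)) y (2 * T) := by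
  obtain ⟨h1, h2⟩ := h
  have hTy := h2 y hxy hy
  have hg : T ≤ p + 1 := by
    by_contra hlt
    have : 0 ≤ (T - 1) * (T - 1 - (p + 1)) := mul_nonneg (by omega) (by omega)
    nlinarith
  have c1 : 0 ≤ (y - T) * (2 * T - 1 - y) := mul_nonneg (by omega) (by omega)
  have c2 : 0 ≤ (p + 1 - T) * (y - T) := mul_nonneg (by omega) (by omega)
  have c3 : 0 ≤ (p + 1 - T) * (2 * T - 1 - y) := mul_nonneg (by omega) (by omega)
  have c4 : 0 ≤ T * (p + 1 - T) := mul_nonneg (by omega) (by omega)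
  have c5 : 0 ≤ T * (y - T) := mul_nonneg (by omega) (by omega)
  have c6 : 0 ≤ T * (2 * T - 1 - y) := mul_nonneg (by omega) (by omega)
  have c7 : 0 ≤ T * (T - 2) := mul_nonneg (by omega) (by omega)
  have h3 : 2 * (2 * T - 1) ^ 2 - 2 * (p + y + 1) * (2 * T - 1) +
      (2 * y ^ 2 - 2 * (p + 1) * y + (d + 2) + 2) < 0 := by nlinarith
  refine ⟨h3, fun z hz hfz => ?_⟩
  by_contra hlt
  have h4 : 2 * y ^ 2 - 2 * (p + y + 1) * y + (2 * y ^ 2 - 2 * (p + 1) * y + (d + 2) + 2) < 0 := by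
    nlinarith
  rcases (show z ≤ 2 * T - 1 by omega).eq_or_lt with rfl | hzlt
  · linarith
  · exact absurd hfz (not_le.2 (chord_neg h4 h3.le hz hzlt))

theorem fast_slow' {P D x y T : ℤ} (hT : 2 ≤ T) (hP : 0 < P) (hTP : T ≤ 2 * P + 2)
    (hD : D ≤ 2 * P * x) (hx : T ≤ x) (hxy : x ≤ y) (hyT : y < 2 * T) :
    SlowState' (P + x + y)
      (2 * y ^ 2 - 2 * (P + x + 1) * y + (2 * x ^ 2 - 2 * (P + 1) * x + (D + 2) + 2)) y
      (2 * T) := by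
  have a1 : 0 ≤ (x - T) * (2 * T - 1 - x) := mul_nonneg (by omega) (by omega)
  have a2 : 0 ≤ (y - T) * (2 * T - 1 - y) := mul_nonneg (by omega) (by omega)
  have a3 : 0 ≤ (x - T) * (2 * T - 1 - y) := mul_nonneg (by omega) (by omega)
  have a4 : 0 ≤ (y - x) * (2 * T - 1 - y) := mul_nonneg (by omega) (by omega)
  have a5 : 0 ≤ (y - x) * (x - T) := mul_nonneg (by omega) (by omega)
  have b1 : 0 ≤ P * (x - T) := mul_nonneg hP.le (by omega)
  have b2 : 0 ≤ P * (y - x) := mul_nonneg hP.le (by omega)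
  have b3 : 0 ≤ T * (2 * P + 2 - T) := mul_nonneg (by omega) (by omega)
  have b4 : 0 ≤ P * (T - 2) := mul_nonneg hP.le (by omega)
  have h3 : 2 * (2 * T - 1) ^ 2 - 2 * (P + x + y + 1) * (2 * T - 1) +
      (2 * y ^ 2 - 2 * (P + x + 1) * y + (2 * x ^ 2 - 2 * (P + 1) * x + (D + 2) + 2) + 2) < 0 := by
    nlinarith
  refine ⟨h3, fun z hz hfz => ?_⟩
  by_contra hlt
  have h4 : 2 * y ^ 2 - 2 * (P + x + y + 1) * y +
      (2 * y ^ 2 - 2 * (P + x + 1) * y + (2 * x ^ 2 - 2 * (P + 1) * x + (D + 2) + 2) + 2) < 0 := by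
    nlinarith
  rcases (show z ≤ 2 * T - 1 by omega).eq_or_lt with rfl | hzlt
  · linarith
  · exact absurd hfz (not_le.2 (chord_neg h4 h3.le hz hzlt))

/-- Growth of a monotone sequence all of whose initial segments satisfy
`(∑ x)² ≤ ∑ (3x² - 2x + 2)`. -/
theorem two_pow_le {k : ℕ} {x : ℕ → ℤ} (hpos : ∀ i < k, 0 < x i)
    (hmono : ∀ i j, i ≤ j → j < k → x i ≤ x j)
    (hsum : ∀ j ≤ k, (∑ i ∈ Finset.range j, x i) ^ 2 ≤
      ∑ i ∈ Finset.range j, (3 * x i ^ 2 - 2 * x i + 2))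
    (hk : 4 ≤ k) : 4 * 2 ^ (k - 4) ≤ x (k - 1) := by
  have key : ∀ j, j + 3 < k →
      SlowState' (∑ i ∈ Finset.range (j + 3), x i)
        (∑ i ∈ Finset.range (j + 3), (3 * x i ^ 2 - 2 * x i + 2) -
          (∑ i ∈ Finset.range (j + 3), x i) ^ 2)
        (x (j + 2)) (4 * 2 ^ j) ∨
      (4 * 2 ^ j ≤ x (j + 2) ∧ 4 * 2 ^ j ≤ 2 * ∑ i ∈ Finset.range (j + 2), x i + 2) := by
    intro j
    induction j with
    | zero =>
      intro h
      simp only [Finset.sum_range_succ, Finset.sum_range_zero, zero_add, pow_zero, mul_one]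
      have h0 := hpos 0 (by omega)
      have h01 := hmono 0 1 (by omega) (by omega)
      have h12 := hmono 1 2 (by omega) (by omega)
      by_cases hc : 4 ≤ x 2
      · exact Or.inr ⟨hc, by omega⟩
      · left
        have e0 : x 0 = 1 ∨ x 0 = 2 ∨ x 0 = 3 := by omega
        have e1 : x 1 = 1 ∨ x 1 = 2 ∨ x 1 = 3 := by omega
        have e2 : x 2 = 1 ∨ x 2 = 2 ∨ x 2 = 3 := by omega
        have H : 2 * (4 - 1) ^ 2 - 2 * (x 0 + x 1 + x 2 + 1) * (4 - 1) +
            (3 * x 0 ^ 2 - 2 * x 0 + 2 + (3 * x 1 ^ 2 - 2 * x 1 + 2) +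
              (3 * x 2 ^ 2 - 2 * x 2 + 2) - (x 0 + x 1 + x 2) ^ 2 + 2) < 0 := by
          rcases e0 with e0 | e0 | e0 <;> rcases e1 with e1 | e1 | e1 <;>
            rcases e2 with e2 | e2 | e2 <;>
            first
            | omega
            | (rw [e0, e1, e2]; norm_num)
        have H' : 2 * x 2 ^ 2 - 2 * (x 0 + x 1 + x 2 + 1) * x 2 +
            (3 * x 0 ^ 2 - 2 * x 0 + 2 + (3 * x 1 ^ 2 - 2 * x 1 + 2) +
              (3 * x 2 ^ 2 - 2 * x 2 + 2) - (x 0 + x 1 + x 2) ^ 2 + 2) < 0 := by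
          rcases e0 with e0 | e0 | e0 <;> rcases e1 with e1 | e1 | e1 <;>
            rcases e2 with e2 | e2 | e2 <;>
            first
            | omega
            | (rw [e0, e1, e2]; norm_num)
        refine ⟨H, fun y hy hf => ?_⟩
        by_contra hlt
        rcases (show y ≤ 4 - 1 by omega).eq_or_lt with rfl | hylt
        · linarith
        · exact absurd hf (not_le.2 (chord_neg H' H.le hy hylt))
    | succ j ih =>
      intro h
      have ih := ih (by omega)
      have hxy := hmono (j + 2) (j + 3) (by omega) (by omega)
      have hx := hpos (j + 2) (by omega)
      have hs := hsum (j + 3) (by omega)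
      have hs' := hsum (j + 4) (by omega)
      have hT1 : (1 : ℤ) ≤ 2 ^ j := one_le_pow₀ (by norm_num)
      have hT : (2 : ℤ) ≤ 4 * 2 ^ j := by linarith
      have hTT : (4 * 2 ^ (j + 1) : ℤ) = 2 * (4 * 2 ^ j) := by ring
      rw [hTT]
      have hP : 0 < ∑ i ∈ Finset.range (j + 2), x i :=
        Finset.sum_pos (fun i hi => hpos i (by grind)) ⟨0, by simp⟩
      have hbound : ∑ i ∈ Finset.range (j + 2), (3 * x i ^ 2 - 2 * x i + 2) -
          (∑ i ∈ Finset.range (j + 2), x i) ^ 2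
          ≤ 2 * (∑ i ∈ Finset.range (j + 2), x i) * x (j + 2) := by
        have h1 := sum_sq_le_sum_mul hpos hmono (show j + 2 < k by omega)
        have h2 := sum_sq_le_sq_sum hpos (show j + 2 ≤ k by omega)
        have h3 : ∑ i ∈ Finset.range (j + 2), (3 * x i ^ 2 - 2 * x i + 2) ≤
            3 * ∑ i ∈ Finset.range (j + 2), x i ^ 2 := by
          rw [Finset.mul_sum]
          exact Finset.sum_le_sum fun i hi => by linarith [hpos i (by grind)]
        linarith
      rw [Finset.sum_range_succ _ (j + 3), Finset.sum_range_succ _ (j + 3)] at hs'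
      rw [show j + 1 + 3 = j + 3 + 1 by ring, show j + 1 + 2 = j + 2 + 1 by ring,
        Finset.sum_range_succ _ (j + 3), Finset.sum_range_succ _ (j + 3)]
      by_cases hlt : x (j + 3) < 2 * (4 * 2 ^ j)
      · left
        rcases ih with ih | ⟨ih1, ih2⟩
        · have := slow_slow' hT (by linarith) ih hxy (by linarith) hlt
          convert this using 1
          ring
        · have := fast_slow' hT hP ih2 hbound ih1 hxy hlt
          rw [Finset.sum_range_succ _ (j + 2), Finset.sum_range_succ _ (j + 2)]
          convert this using 1
          ring
      · right
        refine ⟨by simpa using hlt, ?_⟩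
        rcases ih with ih | ⟨ih1, ih2⟩
        · have hd : 0 ≤ ∑ i ∈ Finset.range (j + 3), (3 * x i ^ 2 - 2 * x i + 2) -
            (∑ i ∈ Finset.range (j + 3), x i) ^ 2 := by linarith
          have h1 := ih.1
          rw [show j + 2 + 1 = j + 3 by ring]
          by_contra hlt
          have := mul_nonneg (show (0 : ℤ) ≤ 4 * 2 ^ j - 1 by linarith)
            (show 0 ≤ 4 * 2 ^ j - 1 - (∑ i ∈ Finset.range (j + 3), x i + 1) by linarith)
          nlinarith
        · rw [Finset.sum_range_succ]
          linarith
  obtain ⟨j, rfl⟩ : ∃ j, k = j + 4 := ⟨k - 4, by omega⟩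
  have hs' := hsum (j + 4) le_rfl
  rw [Finset.sum_range_succ _ (j + 3), Finset.sum_range_succ _ (j + 3)] at hs'
  have hxy := hmono (j + 2) (j + 3) (by omega) (by omega)
  simp only [show j + 4 - 4 = j by omega, show j + 4 - 1 = j + 3 by omega]
  rcases key j (by omega) with h | h
  · exact h.2 _ hxy (by linarith)
  · linarith [h.1]

/-! ### Barriers for perfect matchings -/

open SimpleGraph

open scoped Classical in
/-- `𝒪` is a family of pairwise disjoint sets that cover the complement of `B` and are closed under
adjacency outside `B`. -/
structure IsClosedFamily {X : Type*} (G : SimpleGraph X) (B : Finset X)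
    (𝒪 : Finset (Finset X)) : Prop where
  disjoint : ∀ O ∈ 𝒪, Disjoint O B
  closed : ∀ O ∈ 𝒪, ∀ x ∈ O, ∀ y, G.Adj x y → y ∉ B → y ∈ O
  eq_of_mem : ∀ O ∈ 𝒪, ∀ O' ∈ 𝒪, ∀ x, x ∈ O → x ∈ O' → O = O'
  cover : ∀ x, x ∉ B → ∃ O ∈ 𝒪, x ∈ O

open scoped Classical in
-- Tutte's theorem gives a set whose removal leaves more odd components than it has vertices. The
-- total number of vertices is even, so the two counts have equal parity and the excess is at least
-- 2. The components form the family; connectedness is not recorded, since only closure under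
-- adjacency is needed and this survives the merging of members.
theorem exists_isClosedFamily {X : Type*} [Fintype X] (G : SimpleGraph X)
    (heven : Even (Nat.card X)) (h : ¬ ∃ M : G.Subgraph, M.IsPerfectMatching) :
    ∃ B 𝒪, IsClosedFamily G B 𝒪 ∧ B.card + 2 ≤ (𝒪.filter fun O => Odd O.card).card := by
  rw [tutte] at h
  push Not at h
  obtain ⟨u, hu⟩ := h
  unfold IsTutteViolator at hu
  set K := ((⊤ : G.Subgraph).deleteVerts u).coe with hK
  have hpar := odd_ncard_oddComponents (G := K)
  have hcard : Nat.card ((⊤ : G.Subgraph).deleteVerts u).verts + u.ncard = Nat.card X := by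
    rw [Nat.card_coe_set_eq, Subgraph.deleteVerts_verts, Subgraph.verts_top,
      ← Set.compl_eq_univ_sdiff, add_comm, Set.ncard_add_ncard_compl]
  have hge : u.ncard + 2 ≤ K.oddComponents.ncard := by
    by_contra hlt
    have h1 : K.oddComponents.ncard = u.ncard + 1 := by omega
    rw [h1] at hpar
    have h2 := congrArg Even hcard
    simp only [Nat.even_add, heven] at h2
    rw [Nat.odd_add_one, Nat.not_odd_iff_even] at hpar
    simp only [← Nat.not_even_iff_odd] at hpar
    grind
  have himg : ∀ c : K.ConnectedComponent, ∀ x : ((⊤ : G.Subgraph).deleteVerts u).verts,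
      x.1 ∈ c.supp.toFinset.image Subtype.val ↔ K.connectedComponentMk x = c := by
    intro c x
    rw [Finset.mem_image]
    constructor
    · rintro ⟨y, hy, hyx⟩
      obtain rfl : y = x := Subtype.val_injective hyx
      simpa using hy
    · intro hx
      exact ⟨x, by simpa using hx, rfl⟩
  have hinj : Function.Injective fun c : K.ConnectedComponent =>
      c.supp.toFinset.image Subtype.val := by
    intro c c' hcc
    obtain ⟨v, hv⟩ := c.nonempty_supp
    have h1 := (himg c v).2 hv
    simp only at hcc
    rw [hcc, himg] at h1
    exact hv.symm.trans h1
  refine ⟨u.toFinset, Finset.univ.image fun c : K.ConnectedComponent =>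
    c.supp.toFinset.image Subtype.val, ⟨?_, ?_, ?_, ?_⟩, ?_⟩
  · intro O hO
    obtain ⟨c, -, rfl⟩ := Finset.mem_image.1 hO
    rw [Finset.disjoint_left]
    intro x hx hxu
    obtain ⟨y, -, rfl⟩ := Finset.mem_image.1 hx
    have := y.2
    simp at this hxu
    exact this hxu
  · intro O hO x hx y hxy hy
    obtain ⟨c, -, rfl⟩ := Finset.mem_image.1 hO
    obtain ⟨z, hz, rfl⟩ := Finset.mem_image.1 hx
    have hzu : z.1 ∉ u := by
      have := z.2
      simpa using this
    have hyu : y ∉ u := by simpa using hy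
    rw [himg] at hx
    refine (himg c ⟨y, by simpa using hyu⟩).2 ?_
    have : K.Adj z ⟨y, by simpa using hyu⟩ := by
      simp [hK, hzu, hyu, hxy]
    rw [← hx]
    exact (ConnectedComponent.connectedComponentMk_eq_of_adj this).symm
  · intro O hO O' hO' x hx hx'
    obtain ⟨c, -, rfl⟩ := Finset.mem_image.1 hO
    obtain ⟨c', -, rfl⟩ := Finset.mem_image.1 hO'
    obtain ⟨z, -, rfl⟩ := Finset.mem_image.1 hx
    rw [himg] at hx hx'
    rw [← hx, ← hx']
  · intro x hx
    have hxu : x ∉ u := by simpa using hx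
    exact ⟨_, Finset.mem_image_of_mem _ (Finset.mem_univ (K.connectedComponentMk
      ⟨x, by simpa using hxu⟩)), (himg _ ⟨x, by simpa using hxu⟩).2 rfl⟩
  · rw [← Set.ncard_eq_toFinset_card', Finset.filter_image, Finset.card_image_of_injective _ hinj]
    refine hge.trans (le_of_eq ?_)
    rw [Set.ncard_eq_toFinset_card']
    congr 1
    ext c
    rw [Finset.mem_filter, Finset.card_image_of_injective _ Subtype.val_injective,
      ← Set.ncard_eq_toFinset_card']
    simp

open scoped Classical in
-- Returning b to the graph merges it with all members adjacent to it. If at most two odd members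
-- are merged, at most one odd member is lost, so an excess of 2 persists after b has left the
-- barrier.
theorem IsClosedFamily.erase {X : Type*} {G : SimpleGraph X} {B : Finset X}
    {𝒪 : Finset (Finset X)} (h𝒪 : IsClosedFamily G B 𝒪) {b : X} (hb : b ∈ B)
    (htouch : ((𝒪.filter fun O => Odd O.card).filter fun O => ∃ x ∈ O, G.Adj b x).card ≤ 2) :
    ∃ 𝒪', IsClosedFamily G (B.erase b) 𝒪' ∧
      (𝒪.filter fun O => Odd O.card).card ≤ (𝒪'.filter fun O => Odd O.card).card + 1 := by
  set N := 𝒪.filter fun O => ∃ x ∈ O, G.Adj b x with hN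
  set F := 𝒪.filter fun O => ¬ ∃ x ∈ O, G.Adj b x with hF
  set U := insert b (N.biUnion id) with hU
  have hNO : ∀ O ∈ N, O ∈ 𝒪 := fun O hO => (Finset.mem_filter.1 hO).1
  have hFO : ∀ O ∈ F, O ∈ 𝒪 := fun O hO => (Finset.mem_filter.1 hO).1
  have hbO : ∀ O ∈ 𝒪, b ∉ O := fun O hO hbO => Finset.disjoint_left.1 (h𝒪.disjoint O hO) hbO hb
  have hbN : b ∉ N.biUnion id := by
    simp only [Finset.mem_biUnion, id, not_exists, not_and]
    exact fun O hO => hbO O (hNO O hO)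
  have hUF : ∀ O ∈ F, ∀ x ∈ O, x ∉ U := by
    intro O hO x hx hxU
    rcases Finset.mem_insert.1 hxU with rfl | hxU
    · exact hbO O (hFO O hO) hx
    · obtain ⟨O', hO', hxO'⟩ := Finset.mem_biUnion.1 hxU
      have := h𝒪.eq_of_mem O (hFO O hO) O' (hNO O' hO') x hx hxO'
      subst this
      exact (Finset.mem_filter.1 hO).2 (Finset.mem_filter.1 hO').2
  have hUnot : U ∉ F := fun hUF' => hbO U (hFO U hUF') (Finset.mem_insert_self _ _)
  have hB : ∀ {y}, y ≠ b → y ∉ B.erase b → y ∉ B := fun hyb hy hyB =>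
    hy (Finset.mem_erase.2 ⟨hyb, hyB⟩)
  refine ⟨insert U F, ⟨?_, ?_, ?_, ?_⟩, ?_⟩
  · intro O hO
    rcases Finset.mem_insert.1 hO with rfl | hO
    · rw [Finset.disjoint_left]
      intro x hx hxB
      obtain ⟨hxb, hxB⟩ := Finset.mem_erase.1 hxB
      rcases Finset.mem_insert.1 hx with rfl | hx
      · exact hxb rfl
      · obtain ⟨O', hO', hxO'⟩ := Finset.mem_biUnion.1 hx
        exact Finset.disjoint_left.1 (h𝒪.disjoint O' (hNO O' hO')) hxO' hxB
    · exact (h𝒪.disjoint O (hFO O hO)).mono_right (Finset.erase_subset _ _)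
  · intro O hO x hx y hxy hy
    rcases Finset.mem_insert.1 hO with rfl | hO
    · by_cases hyb : y = b
      · simp [hU, hyb]
      refine Finset.mem_insert_of_mem (Finset.mem_biUnion.2 ?_)
      rcases Finset.mem_insert.1 hx with rfl | hx
      · obtain ⟨O, hO, hyO⟩ := h𝒪.cover y (hB hyb hy)
        exact ⟨O, Finset.mem_filter.2 ⟨hO, y, hyO, hxy⟩, hyO⟩
      · obtain ⟨O', hO', hxO'⟩ := Finset.mem_biUnion.1 hx
        exact ⟨O', hO', h𝒪.closed O' (hNO O' hO') x hxO' y hxy (hB hyb hy)⟩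
    · by_cases hyb : y = b
      · subst hyb
        exact absurd ⟨x, hx, hxy.symm⟩ (Finset.mem_filter.1 hO).2
      · exact h𝒪.closed O (hFO O hO) x hx y hxy (hB hyb hy)
  · intro O hO O' hO' x hx hx'
    rcases Finset.mem_insert.1 hO with rfl | hO <;> rcases Finset.mem_insert.1 hO' with rfl | hO'
    · rfl
    · exact absurd hx (hUF _ hO' x hx')
    · exact absurd hx' (hUF _ hO x hx)
    · exact h𝒪.eq_of_mem O (hFO O hO) O' (hFO O' hO') x hx hx'
  · intro x hx
    by_cases hxb : x = b
    · exact ⟨U, Finset.mem_insert_self _ _, by simp [hU, hxb]⟩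
    · obtain ⟨O, hO, hxO⟩ := h𝒪.cover x (hB hxb hx)
      by_cases hOb : ∃ x ∈ O, G.Adj b x
      · exact ⟨U, Finset.mem_insert_self _ _, Finset.mem_insert_of_mem (Finset.mem_biUnion.2
          ⟨O, Finset.mem_filter.2 ⟨hO, hOb⟩, hxO⟩)⟩
      · exact ⟨O, Finset.mem_insert_of_mem (Finset.mem_filter.2 ⟨hO, hOb⟩), hxO⟩
  · have hsplit : (𝒪.filter fun O => Odd O.card).card =
        (N.filter fun O => Odd O.card).card + (F.filter fun O => Odd O.card).card := by
      rw [← Finset.card_filter_add_card_filter_not (s := 𝒪.filter fun O => Odd O.card)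
        (fun O => ∃ x ∈ O, G.Adj b x)]
      congr 2 <;> rw [Finset.filter_filter, Finset.filter_filter] <;> simp only [and_comm]
    have hle : (N.filter fun O => Odd O.card).card ≤ 2 := by
      rw [Finset.filter_filter] at htouch
      rw [Finset.filter_filter]
      simpa only [and_comm] using htouch
    have hUcard : U.card = 1 + ∑ O ∈ N, O.card := by
      rw [Finset.card_insert_of_notMem hbN, Finset.card_biUnion, add_comm]
      · rfl
      · intro O hO O' hO' hne
        exact Finset.disjoint_left.2 fun x hx hx' =>
          hne (h𝒪.eq_of_mem O (hNO O hO) O' (hNO O' hO') x hx hx')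
    -- An odd merged set replaces at most two odd members. If the merged set is even, the number of
    -- odd members in it is odd and at most 2, hence 1.
    by_cases hUodd : Odd U.card
    · rw [Finset.filter_insert, if_pos hUodd, Finset.card_insert_of_notMem
        fun h => hUnot (Finset.mem_filter.1 h).1]
      omega
    · rw [Finset.filter_insert, if_neg hUodd]
      have : Odd (N.filter fun O => Odd O.card).card := by
        rw [hUcard, add_comm, Nat.odd_add_one, not_not, Finset.odd_sum_iff_odd_card_odd] at hUodd
        exact hUodd
      obtain ⟨m, hm⟩ := this
      omega

open scoped Classical in
/-- In a smallest barrier every vertex is adjacent to at least three odd members. -/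
theorem exists_minimal_isClosedFamily {X : Type*} [Fintype X] (G : SimpleGraph X)
    (heven : Even (Nat.card X)) (h : ¬ ∃ M : G.Subgraph, M.IsPerfectMatching) :
    ∃ B 𝒪, IsClosedFamily G B 𝒪 ∧ B.card + 2 ≤ (𝒪.filter fun O => Odd O.card).card ∧
      ∀ b ∈ B, 3 ≤ ((𝒪.filter fun O => Odd O.card).filter fun O => ∃ x ∈ O, G.Adj b x).card := by
  have hex : ∃ m, ∃ B 𝒪, IsClosedFamily G B 𝒪 ∧
      B.card + 2 ≤ (𝒪.filter fun O => Odd O.card).card ∧ B.card = m := by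
    obtain ⟨B, 𝒪, h1, h2⟩ := exists_isClosedFamily G heven h
    exact ⟨_, B, 𝒪, h1, h2, rfl⟩
  obtain ⟨B, 𝒪, h1, h2, h3⟩ := Nat.find_spec hex
  refine ⟨B, 𝒪, h1, h2, fun b hb => ?_⟩
  by_contra hlt
  obtain ⟨𝒪', h1', h2'⟩ := h1.erase hb (by omega)
  have hcard := Finset.card_erase_of_mem hb
  have hpos := Finset.card_pos.2 ⟨b, hb⟩
  exact Nat.find_min hex (m := (B.erase b).card) (by omega) ⟨_, 𝒪', h1', by omega, rfl⟩

/-! ### 2-factors through Tutte's gadget -/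

/-- The graph has a spanning `2`-regular subgraph. -/
def HasTwoFactor {V : Type*} (G : SimpleGraph V) : Prop :=
  ∃ H ≤ G, ∀ v, (H.neighborSet v).ncard = 2

/-- Tutte's gadget: two copies of each vertex, one node for each dart; perfect matchings of the
gadget correspond to `2`-factors. -/
def gadget {V : Type*} (G : SimpleGraph V) : SimpleGraph ((V × Bool) ⊕ G.Dart) where
  Adj x y := match x, y with
    | .inl p, .inr d => d.fst = p.1
    | .inr d, .inl p => d.fst = p.1
    | .inr d, .inr d' => d' = d.symm
    | .inl _, .inl _ => False
  symm := ⟨fun x y => by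
    rcases x with p | d <;> rcases y with p' | d' <;> simp
    rintro rfl
    simp⟩
  loopless := ⟨fun x => by
    rcases x with p | d
    · simp
    · simp only
      exact fun h => d.symm_ne h.symm⟩

@[simp] theorem gadget_adj_inl_inr {V : Type*} {G : SimpleGraph V} (p : V × Bool) (d : G.Dart) :
    (gadget G).Adj (.inl p) (.inr d) ↔ d.fst = p.1 := Iff.rfl

@[simp] theorem gadget_adj_inr_inl {V : Type*} {G : SimpleGraph V} (p : V × Bool) (d : G.Dart) :
    (gadget G).Adj (.inr d) (.inl p) ↔ d.fst = p.1 := Iff.rfl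

@[simp] theorem gadget_adj_inr_inr {V : Type*} {G : SimpleGraph V} (d d' : G.Dart) :
    (gadget G).Adj (.inr d) (.inr d') ↔ d' = d.symm := Iff.rfl

@[simp] theorem gadget_adj_inl_inl {V : Type*} {G : SimpleGraph V} (p p' : V × Bool) :
    ¬ (gadget G).Adj (.inl p) (.inl p') := fun h => h

/-- A dart matched to its reverse stands for an edge left out. Otherwise the dart and its reverse
are both matched to vertex copies, and the edge is taken. The two copies of u select two different
darts at u, and every edge taken at u arises in this way. -/
theorem hasTwoFactor_of_isPerfectMatching {V : Type*} {G : SimpleGraph V}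
    {M : (gadget G).Subgraph} (hM : M.IsPerfectMatching) : HasTwoFactor G := by
  rw [Subgraph.isPerfectMatching_iff] at hM
  choose m hm hm' using hM
  have hmm : ∀ x y, M.Adj x y ↔ y = m x := fun x y => ⟨fun h => hm' x y h, fun h => h ▸ hm x⟩
  have hinv : ∀ x, m (m x) = x := fun x => ((hmm _ _).1 (hm x).symm).symm
  have hadj : ∀ x, (gadget G).Adj x (m x) := fun x => (hm x).adj_sub
  have hcopy : ∀ p : V × Bool, ∃ d : G.Dart, m (.inl p) = .inr d ∧ d.fst = p.1 := by
    intro p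
    have := hadj (.inl p)
    rcases hp : m (.inl p) with p' | d
    · rw [hp] at this
      exact absurd this (gadget_adj_inl_inl _ _)
    · rw [hp] at this
      exact ⟨d, rfl, this⟩
  have hdart : ∀ d : G.Dart, (∃ p, m (.inr d) = .inl p) ↔ m (.inr d) ≠ .inr d.symm := by
    intro d
    have := hadj (.inr d)
    rcases hp : m (.inr d) with p' | d'
    · simp
    · rw [hp] at this
      rw [gadget_adj_inr_inr] at this
      simp [this]
  have hdart_symm : ∀ d : G.Dart, m (.inr d.symm) = .inr d ↔ m (.inr d) = .inr d.symm := by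
    intro d
    constructor <;> intro h
    · rw [← h, hinv]
    · rw [← h, hinv]
  refine ⟨⟨fun u v => ∃ h : G.Adj u v, m (.inr ⟨(u, v), h⟩) ≠ .inr ⟨(v, u), h.symm⟩, ?_, ?_⟩,
    ?_, ?_⟩
  · refine ⟨?_⟩
    rintro u v ⟨h, hne⟩
    exact ⟨h.symm, fun h' => hne ((hdart_symm ⟨(u, v), h⟩).1 h')⟩
  · refine ⟨?_⟩
    rintro u ⟨h, -⟩
    exact h.ne rfl
  · rintro u v ⟨h, -⟩
    exact h
  · intro u
    obtain ⟨d₁, h1, hu1⟩ := hcopy (u, true)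
    obtain ⟨d₂, h2, hu2⟩ := hcopy (u, false)
    have hne : d₁ ≠ d₂ := by
      rintro rfl
      have := congrArg m (h1.trans h2.symm)
      rw [hinv, hinv] at this
      simp at this
    have hsnd : d₁.snd ≠ d₂.snd := fun h => hne (Dart.ext _ _ (Prod.ext (hu1.trans hu2.symm) h))
    rw [← Set.ncard_pair hsnd]
    congr 1
    ext v
    simp only [mem_neighborSet, Set.mem_insert_iff, Set.mem_singleton_iff]
    constructor
    · rintro ⟨h, hv⟩
      obtain ⟨⟨w, b⟩, hp⟩ := (hdart ⟨(u, v), h⟩).2 hv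
      have hw := hadj (.inr ⟨(u, v), h⟩)
      rw [hp, gadget_adj_inr_inl] at hw
      simp only at hw
      subst hw
      have hp' := congrArg m hp
      rw [hinv] at hp'
      cases b
      · rw [h2] at hp'
        right
        rw [← Sum.inr_injective hp']
      · rw [h1] at hp'
        left
        rw [← Sum.inr_injective hp']
    · have key : ∀ (b : Bool) (d : G.Dart), m (.inl (u, b)) = .inr d → d.fst = u → v = d.snd →
          ∃ h : G.Adj u v, m (.inr ⟨(u, v), h⟩) ≠ .inr ⟨(v, u), h.symm⟩ := by
        rintro b ⟨⟨x, y⟩, h⟩ hd hx hy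
        simp only at hx hy
        subst hx hy
        refine ⟨h, ?_⟩
        rw [← hd, hinv]
        simp
      rintro (rfl | rfl)
      · exact key true d₁ h1 hu1 rfl
      · exact key false d₂ h2 hu2 rfl

open scoped Classical in
/-- The number of neighbors of `v` in `A`. -/
noncomputable def nb {V : Type*} (G : SimpleGraph V) (v : V) (A : Finset V) : ℕ :=
  (A.filter fun w => G.Adj v w).card

theorem sum_nb_comm {V : Type*} (G : SimpleGraph V) (A A' : Finset V) :
    ∑ v ∈ A, nb G v A' = ∑ v ∈ A', nb G v A := by
  classical
  have := Finset.sum_card_bipartiteAbove_eq_sum_card_bipartiteBelow (s := A) (t := A') G.Adj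
  simp only [Finset.bipartiteAbove, Finset.bipartiteBelow] at this
  unfold nb
  convert this using 3 with v hv v hv
  congr 1
  ext w
  simp [G.adj_comm]

theorem card_darts_between {V : Type*} [Fintype V] [DecidableEq V] (G : SimpleGraph V)
    [DecidableRel G.Adj] (A A' : Finset V) :
    (Finset.univ.filter fun d : G.Dart => d.fst ∈ A ∧ d.snd ∈ A').card = ∑ v ∈ A, nb G v A' := by
  classical
  unfold nb
  rw [← Finset.card_sigma]
  refine Finset.card_bij (fun d _ => ⟨d.fst, d.snd⟩) ?_ ?_ ?_
  · intro d hd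
    simp only [Finset.mem_filter, Finset.mem_univ, true_and] at hd
    simp [hd, d.adj]
  · intro d _ d' _ h
    simp only [Sigma.mk.injEq, heq_eq_eq] at h
    exact Dart.ext _ _ (Prod.ext h.1 h.2)
  · rintro ⟨v, w⟩ h
    simp only [Finset.mem_sigma, Finset.mem_filter] at h
    exact ⟨⟨(v, w), h.2.2⟩, by simp [h], rfl⟩

theorem nb_univ_eq {V : Type*} [Fintype V] [DecidableEq V] (G : SimpleGraph V) (v : V)
    (A : Finset V) : nb G v Finset.univ = nb G v A + nb G v Aᶜ := by
  classical
  unfold nb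
  rw [← Finset.card_union_of_disjoint, ← Finset.filter_union, Finset.union_compl]
  exact Finset.disjoint_filter_filter disjoint_compl_right

theorem card_le_of_forall_mem {X : Type*} {τ : Finset (Finset X)} {P : Finset X}
    (hdisj : ∀ O ∈ τ, ∀ O' ∈ τ, ∀ x, x ∈ O → x ∈ O' → O = O')
    (hP : ∀ O ∈ τ, ∃ x ∈ P, x ∈ O) : τ.card ≤ P.card := by
  rcases τ.eq_empty_or_nonempty with rfl | ⟨O₀, hO₀⟩
  · simp
  have : Nonempty X := ⟨(hP O₀ hO₀).choose⟩
  choose! f hf hf' using hP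
  refine Finset.card_le_card_of_injOn f hf fun O hO O' hO' h => ?_
  exact hdisj O hO O' hO' (f O) (hf' O hO) (h ▸ hf' O' hO')

theorem even_card_of_involution {X : Type*} {Q : Finset X} (σ : X → X)
    (hmem : ∀ x ∈ Q, σ x ∈ Q) (hne : ∀ x ∈ Q, σ x ≠ x) (hinv : ∀ x ∈ Q, σ (σ x) = x) :
    Even Q.card := by
  have h : ∑ x ∈ Q, (1 : ZMod 2) = 0 :=
    Finset.sum_involution (fun x _ => σ x) (fun _ _ => by decide) (fun x hx _ => hne x hx)
      (fun x hx => hmem x hx) (fun x hx => hinv x hx)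
  rw [Finset.sum_const, nsmul_eq_mul, mul_one] at h
  exact (ZMod.natCast_eq_zero_iff_even).1 h

/-- A certificate that a graph has no `2`-factor. -/
structure IsTwoFactorBarrier {V : Type*} [Fintype V] [DecidableEq V] (G : SimpleGraph V)
    (S T : Finset V) (𝒞 : Finset (Finset V)) : Prop where
  disjoint : Disjoint S T
  notMem_left : ∀ C ∈ 𝒞, ∀ v ∈ C, v ∉ S
  notMem_right : ∀ C ∈ 𝒞, ∀ v ∈ C, v ∉ T
  closed : ∀ C ∈ 𝒞, ∀ v ∈ C, ∀ w, G.Adj v w → w ∉ S → w ∉ T → w ∈ C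
  eq_of_mem : ∀ C ∈ 𝒞, ∀ C' ∈ 𝒞, ∀ v, v ∈ C → v ∈ C' → C = C'
  odd : ∀ C ∈ 𝒞, Odd (∑ v ∈ C, nb G v T)
  deficient : ∑ v ∈ T, nb G v Sᶜ + 2 * S.card + 2 ≤ 2 * T.card + 𝒞.card

theorem even_card_gadget {V : Type*} [Finite V] (G : SimpleGraph V) :
    Even (Nat.card ((V × Bool) ⊕ G.Dart)) := by
  classical
  have := Fintype.ofFinite V
  rw [Nat.card_eq_fintype_card, Fintype.card_sum, Fintype.card_prod, Fintype.card_bool,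
    G.dart_card_eq_twice_card_edges]
  exact (even_two.mul_left _).add (even_two_mul _)

set_option maxHeartbeats 1000000 in
-- In a smallest barrier B of the gadget every node touches three odd members. This forces B to
-- consist of both copies of the vertices of a set S and of all darts leaving a set T. Without B,
-- the copies of T and the darts from S to T are isolated. Every other odd member comes from a
-- vertex set closed under adjacency outside S and T, and comparing the counts gives the deficiency.
theorem exists_isTwoFactorBarrier {V : Type*} [Fintype V] [DecidableEq V] {G : SimpleGraph V}
    (hG : ¬ HasTwoFactor G) (hdeg : ∀ v, ∃ w, G.Adj v w) :
    ∃ S T 𝒞, IsTwoFactorBarrier G S T 𝒞 := by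
  classical
  obtain ⟨B, 𝒪, h𝒪, hdef, htouch⟩ := exists_minimal_isClosedFamily (gadget G)
    (even_card_gadget G) fun ⟨M, hM⟩ => hG (hasTwoFactor_of_isPerfectMatching hM)
  set 𝒟 := 𝒪.filter fun O => Odd O.card with h𝒟
  have h𝒟𝒪 : ∀ O ∈ 𝒟, O ∈ 𝒪 := fun O hO => (Finset.mem_filter.1 hO).1
  have hOB : ∀ O ∈ 𝒪, ∀ x ∈ O, x ∉ B := fun O hO x hx => Finset.disjoint_left.1 (h𝒪.disjoint O hO) hx
  -- At least three disjoint members touch b, so two nodes cannot meet all of them.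
  have hτ : ∀ b, ∀ P : Finset ((V × Bool) ⊕ G.Dart), b ∈ B → P.card ≤ 2 →
      ∃ O ∈ 𝒪, (∃ x ∈ O, (gadget G).Adj b x) ∧ ∀ x ∈ P, x ∉ O := by
    intro b P hb hP
    by_contra hcon
    push Not at hcon
    have := card_le_of_forall_mem (τ := 𝒟.filter fun O => ∃ x ∈ O, (gadget G).Adj b x) (P := P)
      (fun O hO O' hO' => h𝒪.eq_of_mem O (h𝒟𝒪 O (Finset.mem_filter.1 hO).1) O'
        (h𝒟𝒪 O' (Finset.mem_filter.1 hO').1))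
      (fun O hO => hcon O (h𝒟𝒪 O (Finset.mem_filter.1 hO).1) (Finset.mem_filter.1 hO).2)
    have := htouch b hb
    omega
  -- A dart has only three neighbors: the two copies of its first vertex and its reverse. If it is
  -- in B, they must lie in three different members, in particular outside B.
  have hdartB : ∀ d : G.Dart, .inr d ∈ B → ∀ β, .inl (d.fst, β) ∉ B ∧
      ∀ O ∈ 𝒪, .inl (d.fst, β) ∈ O → .inl (d.fst, !β) ∉ O := by
    intro d hd β
    constructor
    · obtain ⟨O, hO, ⟨x, hx, hdx⟩, hP⟩ := hτ (.inr d) {.inl (d.fst, !β), .inr d.symm} hd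
        Finset.card_le_two
      rcases x with ⟨u, γ⟩ | d'
      · rw [gadget_adj_inr_inl] at hdx
        simp only at hdx
        subst hdx
        have hγ : γ = β := by
          by_contra hne
          have : γ = !β := by cases γ <;> cases β <;> simp_all
          subst this
          exact hP _ (by simp) hx
        subst hγ
        exact hOB O hO _ hx
      · rw [gadget_adj_inr_inr] at hdx
        subst hdx
        exact absurd hx (hP _ (by simp))
    · intro O₀ hO₀ h1 h2
      obtain ⟨O, hO, ⟨x, hx, hdx⟩, hP⟩ := hτ (.inr d) {.inl (d.fst, !β), .inr d.symm} hd
        Finset.card_le_two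
      rcases x with ⟨u, γ⟩ | d'
      · rw [gadget_adj_inr_inl] at hdx
        simp only at hdx
        subst hdx
        have hγ : γ = β := by
          by_contra hne
          have : γ = !β := by cases γ <;> cases β <;> simp_all
          subst this
          exact hP _ (by simp) hx
        subst hγ
        have := h𝒪.eq_of_mem O hO O₀ hO₀ _ hx h1
        subst this
        exact hP _ (by simp) h2
      · rw [gadget_adj_inr_inr] at hdx
        subst hdx
        exact absurd hx (hP _ (by simp))
  -- The two copies of a vertex have the same neighbors. A copy outside B would lie in every member
  -- that touches its twin.
  have hcopyB : ∀ u β, .inl (u, β) ∈ B → .inl (u, !β) ∈ B := by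
    intro u β h
    obtain ⟨O, hO, ⟨x, hx, hux⟩, hP⟩ := hτ _ {.inl (u, !β)} h (by simp)
    by_contra hnot
    rcases x with p | d
    · exact gadget_adj_inl_inl _ _ hux
    · exact hP _ (by simp) (h𝒪.closed O hO _ hx _ (by simpa using hux) hnot)
  have hcopyB' : ∀ u β, .inl (u, β) ∈ B ↔ .inl (u, true) ∈ B := by
    intro u β
    cases β
    · exact ⟨hcopyB u false, hcopyB u true⟩
    · rfl
  set S := Finset.univ.filter fun u : V => (.inl (u, true) : (V × Bool) ⊕ G.Dart) ∈ B with hS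
  set T := Finset.univ.filter fun u : V => ∃ d : G.Dart, d.fst = u ∧ .inr d ∈ B with hT
  have hmemS : ∀ u β, .inl (u, β) ∈ B ↔ u ∈ S := fun u β => by simp [hS, hcopyB' u β]
  -- A dart outside B would bring both copies of its first vertex into one member, contrary to
  -- `hdartB`.
  have hmemT : ∀ d : G.Dart, .inr d ∈ B ↔ d.fst ∈ T := by
    intro d
    refine ⟨fun h => Finset.mem_filter.2 ⟨Finset.mem_univ _, d, rfl, h⟩, fun h => ?_⟩
    obtain ⟨-, d', hd', hB⟩ := Finset.mem_filter.1 h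
    by_contra hd
    obtain ⟨O, hO, hdO⟩ := h𝒪.cover _ hd
    have hβ : ∀ β, .inl (d.fst, β) ∈ O := fun β =>
      h𝒪.closed O hO _ hdO _ (by simp) (hd' ▸ (hdartB d' hB β).1)
    have := (hdartB d' hB true).2 O hO
    rw [hd'] at this
    exact this (hβ true) (hβ _)
  have hST : Disjoint S T := by
    rw [Finset.disjoint_left]
    intro u huS huT
    obtain ⟨-, d, rfl, hd⟩ := Finset.mem_filter.1 huT
    exact (hdartB d hd true).1 ((hmemS _ _).2 huS)
  -- These are the nodes isolated by B. Only the bound by |P| on the number of disjoint members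
  -- meeting P is needed.
  set P := (T ×ˢ (Finset.univ : Finset Bool)).disjSum
    (Finset.univ.filter fun d : G.Dart => d.fst ∈ S ∧ d.snd ∈ T) with hP
  have hPl : ∀ p, .inl p ∈ P ↔ p.1 ∈ T := fun p => by simp [hP]
  have hPr : ∀ d, .inr d ∈ P ↔ d.fst ∈ S ∧ d.snd ∈ T := fun d => by simp [hP]
  have hPcard : P.card = 2 * T.card + ∑ v ∈ T, nb G v S := by
    rw [hP, Finset.card_disjSum, card_darts_between, sum_nb_comm, Finset.card_product]
    simp [mul_comm]
  have hBcard : 2 * S.card + ∑ v ∈ T, nb G v Finset.univ ≤ B.card := by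
    rw [← card_darts_between]
    refine le_trans (le_of_eq ?_) (Finset.card_le_card (s := (S ×ˢ (Finset.univ : Finset Bool)).disjSum
      (Finset.univ.filter fun d : G.Dart => d.fst ∈ T ∧ d.snd ∈ Finset.univ)) ?_)
    · rw [Finset.card_disjSum, Finset.card_product]
      simp [mul_comm]
    · rintro (⟨u, β⟩ | d) hx
      · rw [hmemS]
        simpa using hx
      · rw [hmemT]
        simpa using hx
  set 𝒟₁ := 𝒟.filter fun O => ∃ x ∈ P, x ∈ O
  set 𝒟₂ := 𝒟.filter fun O => ¬ ∃ x ∈ P, x ∈ O with h𝒟₂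
  have hsplit : 𝒟₁.card + 𝒟₂.card = 𝒟.card := Finset.card_filter_add_card_filter_not _
  have h𝒟₁ : 𝒟₁.card ≤ P.card := card_le_of_forall_mem
    (fun O hO O' hO' => h𝒪.eq_of_mem O (h𝒟𝒪 O (Finset.mem_filter.1 hO).1) O'
        (h𝒟𝒪 O' (Finset.mem_filter.1 hO').1)) fun O hO => (Finset.mem_filter.1 hO).2
  have h𝒟₂𝒪 : ∀ O ∈ 𝒟₂, O ∈ 𝒪 := fun O hO => h𝒟𝒪 O (Finset.mem_filter.1 hO).1
  have hPO : ∀ O ∈ 𝒟₂, ∀ x ∈ O, x ∉ P := fun O hO x hx hxP =>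
    (Finset.mem_filter.1 hO).2 ⟨x, hxP, hx⟩
  let c : Finset ((V × Bool) ⊕ G.Dart) → Finset V := fun O =>
    Finset.univ.filter fun u => .inl (u, true) ∈ O
  have hc : ∀ O u, u ∈ c O ↔ .inl (u, true) ∈ O := fun O u => by simp [c]
  have hcS : ∀ O ∈ 𝒟₂, ∀ u ∈ c O, u ∉ S := fun O hO u hu huS =>
    hOB O (h𝒟₂𝒪 O hO) _ ((hc O u).1 hu) ((hmemS _ _).2 huS)
  have hcT : ∀ O ∈ 𝒟₂, ∀ u ∈ c O, u ∉ T := fun O hO u hu huT =>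
    hPO O hO _ ((hc O u).1 hu) ((hPl _).2 huT)
  have hcd : ∀ O ∈ 𝒟₂, ∀ d : G.Dart, d.fst ∈ c O → .inr d ∈ O := fun O hO d hd =>
    h𝒪.closed O (h𝒟₂𝒪 O hO) _ ((hc O _).1 hd) _ (by simp)
      fun h => hcT O hO _ hd ((hmemT d).1 h)
  have hdc : ∀ O ∈ 𝒟₂, ∀ d : G.Dart, .inr d ∈ O → d.fst ∉ S → d.fst ∈ c O := fun O hO d hd hdS =>
    (hc O _).2 (h𝒪.closed O (h𝒟₂𝒪 O hO) _ hd _ (by simp) fun h => hdS ((hmemS _ _).1 h))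
  have hodd : ∀ O ∈ 𝒟₂, Odd (∑ v ∈ c O, nb G v T) := by
    intro O hO
    have hOodd : Odd O.card := (Finset.mem_filter.1 (Finset.mem_filter.1 hO).1).2
    -- Swapping copies and reversing darts has no fixed point, so |O| has the parity of the number
    -- of nodes sent out of O. These are the darts from `c O` to T.
    let σ : (V × Bool) ⊕ G.Dart → (V × Bool) ⊕ G.Dart :=
      Sum.map (fun p => (p.1, !p.2)) Dart.symm
    have hσσ : ∀ x, σ (σ x) = x := by
      rintro (⟨u, β⟩ | d) <;> simp [σ]
    have hQ : Even (O.filter fun x => σ x ∈ O).card := by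
      refine even_card_of_involution σ ?_ ?_ fun x _ => hσσ x
      · intro x hx
        obtain ⟨h1, h2⟩ := Finset.mem_filter.1 hx
        exact Finset.mem_filter.2 ⟨h2, (hσσ x).symm ▸ h1⟩
      · rintro (⟨u, β⟩ | d) -
        · simp [σ]
        · simpa [σ] using d.symm_ne
    have hR : (O.filter fun x => ¬ σ x ∈ O).card = ∑ v ∈ c O, nb G v T := by
      rw [← card_darts_between]
      symm
      refine Finset.card_bij (fun d _ => .inr d) ?_ ?_ ?_
      · intro d hd
        simp only [Finset.mem_filter, Finset.mem_univ, true_and] at hd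
        refine Finset.mem_filter.2 ⟨hcd O hO d hd.1, fun h => ?_⟩
        exact hOB O (h𝒟₂𝒪 O hO) _ h ((hmemT d.symm).2 hd.2)
      · intro d _ d' _ h
        exact Sum.inr_injective h
      · rintro (⟨u, β⟩ | d) hx
        · exfalso
          obtain ⟨h1, h2⟩ := Finset.mem_filter.1 hx
          -- Any dart leaving u ties the two copies of u together; an isolated vertex would have
          -- none.
          obtain ⟨w, hw⟩ := hdeg u
          have huT : u ∉ T := fun h => hPO O hO _ h1 ((hPl _).2 h)
          have hdO : .inr ⟨(u, w), hw⟩ ∈ O := h𝒪.closed O (h𝒟₂𝒪 O hO) _ h1 _ (by simp)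
            fun h => huT ((hmemT _).1 h)
          refine h2 (h𝒪.closed O (h𝒟₂𝒪 O hO) _ hdO _ (by exact rfl) fun h => ?_)
          exact hOB O (h𝒟₂𝒪 O hO) _ h1 ((hmemS _ _).2 ((hmemS _ _).1 h))
        · obtain ⟨h1, h2⟩ := Finset.mem_filter.1 hx
          have hsymm : d.snd ∈ T := by
            by_contra hnot
            exact h2 (h𝒪.closed O (h𝒟₂𝒪 O hO) _ h1 _ (by simp [σ])
              fun h => hnot ((hmemT d.symm).1 h))
          refine ⟨d, ?_, rfl⟩
          simp only [Finset.mem_filter, Finset.mem_univ, true_and]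
          refine ⟨hdc O hO d h1 fun hdS => ?_, hsymm⟩
          exact hPO O hO _ h1 ((hPr d).2 ⟨hdS, hsymm⟩)
    rw [← hR]
    have := Finset.card_filter_add_card_filter_not (s := O) (fun x => σ x ∈ O)
    rw [← this] at hOodd
    exact (Nat.odd_add'.1 hOodd).2 hQ
  have hinj : Set.InjOn c 𝒟₂ := by
    intro O hO O' hO' h
    have hne : (c O).Nonempty := by
      rw [Finset.nonempty_iff_ne_empty]
      intro hemp
      have := hodd O hO
      rw [hemp] at this
      simp at this
    obtain ⟨u, hu⟩ := hne
    exact h𝒪.eq_of_mem O (h𝒟₂𝒪 O hO) O' (h𝒟₂𝒪 O' hO') _ ((hc O u).1 hu) ((hc O' u).1 (h ▸ hu))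
  refine ⟨S, T, 𝒟₂.image c, hST, ?_, ?_, ?_, ?_, ?_, ?_⟩
  · intro C hC
    obtain ⟨O, hO, rfl⟩ := Finset.mem_image.1 hC
    exact hcS O hO
  · intro C hC
    obtain ⟨O, hO, rfl⟩ := Finset.mem_image.1 hC
    exact hcT O hO
  · intro C hC v hv w hvw hwS hwT
    obtain ⟨O, hO, rfl⟩ := Finset.mem_image.1 hC
    have h1 := hcd O hO ⟨(v, w), hvw⟩ hv
    have h2 : .inr ⟨(w, v), hvw.symm⟩ ∈ O := h𝒪.closed O (h𝒟₂𝒪 O hO) _ h1 _ (by simp [Dart.symm])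
      fun h => hwT ((hmemT _).1 h)
    exact hdc O hO ⟨(w, v), hvw.symm⟩ h2 hwS
  · intro C hC C' hC' v hv hv'
    obtain ⟨O, hO, rfl⟩ := Finset.mem_image.1 hC
    obtain ⟨O', hO', rfl⟩ := Finset.mem_image.1 hC'
    rw [h𝒪.eq_of_mem O (h𝒟₂𝒪 O hO) O' (h𝒟₂𝒪 O' hO') _ ((hc O v).1 hv) ((hc O' v).1 hv')]
  · intro C hC
    obtain ⟨O, hO, rfl⟩ := Finset.mem_image.1 hC
    exact hodd O hO
  · rw [Finset.card_image_of_injOn hinj]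
    have : ∑ v ∈ T, nb G v Finset.univ = ∑ v ∈ T, nb G v S + ∑ v ∈ T, nb G v Sᶜ := by
      rw [← Finset.sum_add_distrib]
      exact Finset.sum_congr rfl fun v _ => nb_univ_eq G v S
    omega

/-! ### Degrees in graphs without a 2-factor -/

section nb

variable {V : Type*} (G : SimpleGraph V)

theorem nb_mono (v : V) {A A' : Finset V} (h : A ⊆ A') : nb G v A ≤ nb G v A' := by
  classical
  exact Finset.card_le_card (Finset.filter_subset_filter _ h)

theorem nb_le_card (v : V) (A : Finset V) : nb G v A ≤ A.card := by
  classical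
  exact Finset.card_filter_le _ _

theorem nb_union_le [DecidableEq V] (v : V) (A A' : Finset V) : nb G v (A ∪ A') ≤ nb G v A + nb G v A' := by
  classical
  unfold nb
  rw [Finset.filter_union]
  exact Finset.card_union_le _ _

theorem nb_insert [DecidableEq V] {v y : V} {A : Finset V} (hy : y ∉ A) :
    nb G v (insert y A) = nb G v A + nb G v {y} := by
  classical
  unfold nb
  rw [Finset.insert_eq, Finset.filter_union, Finset.card_union_of_disjoint, add_comm]
  exact Finset.disjoint_filter_filter (by simpa using hy)

/-- The number of vertices of degree at most `D`. -/
noncomputable def lowCount [Fintype V] (D : ℕ) : ℕ :=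
  (Finset.univ.filter fun v => nb G v Finset.univ ≤ D).card

theorem lowCount_mono [Fintype V] {D D' : ℕ} (h : D ≤ D') : lowCount G D ≤ lowCount G D' :=
  Finset.card_le_card fun v hv => by
    simp only [Finset.mem_filter, Finset.mem_univ, true_and] at hv ⊢
    omega

end nb

namespace IsTwoFactorBarrier

variable {V : Type*} [Fintype V] [DecidableEq V] {G : SimpleGraph V} {S T : Finset V}
  {𝒞 : Finset (Finset V)}

/-- The larger S costs 2 and the lost set costs 1, but the number of edges leaving T drops by at
least 3. -/
theorem move (h : IsTwoFactorBarrier G S T 𝒞) {y : V} (hy : {y} ∈ 𝒞) (hy3 : 3 ≤ nb G y T) :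
    IsTwoFactorBarrier G (insert y S) T (𝒞.erase {y}) := by
  have hyS := h.notMem_left _ hy y (Finset.mem_singleton_self y)
  have hyT := h.notMem_right _ hy y (Finset.mem_singleton_self y)
  refine ⟨?_, ?_, ?_, ?_, ?_, ?_, ?_⟩
  · rw [Finset.disjoint_insert_left]
    exact ⟨hyT, h.disjoint⟩
  · intro C hC v hv hvS
    obtain ⟨hne, hC'⟩ := Finset.mem_erase.1 hC
    rcases Finset.mem_insert.1 hvS with rfl | hvS
    · exact hne (h.eq_of_mem C hC' _ hy v hv (Finset.mem_singleton_self v))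
    · exact h.notMem_left C hC' v hv hvS
  · exact fun C hC => h.notMem_right C (Finset.mem_of_mem_erase hC)
  · exact fun C hC v hv w hvw hwS hwT => h.closed C (Finset.mem_of_mem_erase hC) v hv w hvw
      (fun hw => hwS (Finset.mem_insert_of_mem hw)) hwT
  · exact fun C hC C' hC' => h.eq_of_mem C (Finset.mem_of_mem_erase hC) C'
      (Finset.mem_of_mem_erase hC')
  · exact fun C hC => h.odd C (Finset.mem_of_mem_erase hC)
  · have h1 : ∑ v ∈ T, nb G v Sᶜ = ∑ v ∈ T, nb G v (insert y S)ᶜ + nb G y T := by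
      have : nb G y T = ∑ v ∈ T, nb G v {y} := by
        rw [sum_nb_comm, Finset.sum_singleton]
      rw [this, ← Finset.sum_add_distrib]
      refine Finset.sum_congr rfl fun v _ => ?_
      rw [← nb_insert G (by simp)]
      congr 1
      ext w
      simp only [Finset.mem_compl, Finset.mem_insert]
      by_cases hw : w = y <;> simp [hw, hyS]
    have h2 := h.deficient
    have h3 := Finset.card_erase_of_mem hy
    have h4 := Finset.card_insert_of_notMem hyS
    have h5 := Finset.card_pos.2 ⟨_, hy⟩
    omega

/-- For S as large as possible `move` no longer applies, and an odd number below 3 is 1. -/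
theorem exists_singletons (h : IsTwoFactorBarrier G S T 𝒞) :
    ∃ S T 𝒞, IsTwoFactorBarrier G S T 𝒞 ∧ ∀ y, {y} ∈ 𝒞 → nb G y T = 1 := by
  classical
  obtain ⟨⟨S', T', 𝒞'⟩, hmem, hmax⟩ := Finset.exists_max_image
    (Finset.univ.filter fun p : Finset V × Finset V × Finset (Finset V) =>
      IsTwoFactorBarrier G p.1 p.2.1 p.2.2) (fun p => p.1.card) ⟨(S, T, 𝒞), by simpa using h⟩
  simp only [Finset.mem_filter, Finset.mem_univ, true_and] at hmem hmax
  refine ⟨S', T', 𝒞', hmem, fun y hy => ?_⟩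
  by_contra hne
  have hodd := hmem.odd _ hy
  rw [Finset.sum_singleton] at hodd
  obtain ⟨m, hm⟩ := hodd
  have := hmax (insert y S', T', 𝒞'.erase {y}) (hmem.move hy (by omega))
  have hyS := hmem.notMem_left _ hy y (Finset.mem_singleton_self y)
  simp only [Finset.card_insert_of_notMem hyS] at this
  omega

theorem nonempty (h : IsTwoFactorBarrier G S T 𝒞) {C : Finset V} (hC : C ∈ 𝒞) : C.Nonempty := by
  rw [Finset.nonempty_iff_ne_empty]
  rintro rfl
  simpa using h.odd _ hC

theorem pairwiseDisjoint (h : IsTwoFactorBarrier G S T 𝒞) :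
    (𝒞 : Set (Finset V)).PairwiseDisjoint id := fun C hC C' hC' hne =>
  Finset.disjoint_left.2 fun v hv hv' => hne (h.eq_of_mem C hC C' hC' v hv hv')

theorem sum_edges_le (h : IsTwoFactorBarrier G S T 𝒞) :
    ∑ C ∈ 𝒞, ∑ v ∈ C, nb G v T ≤ ∑ v ∈ T, nb G v Sᶜ := by
  have h1 : ∑ C ∈ 𝒞, ∑ v ∈ C, nb G v T = ∑ v ∈ 𝒞.biUnion id, nb G v T :=
    (Finset.sum_biUnion h.pairwiseDisjoint).symm
  rw [h1, sum_nb_comm]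
  refine Finset.sum_le_sum fun v _ => nb_mono G v fun w hw => ?_
  obtain ⟨C, hC, hwC⟩ := Finset.mem_biUnion.1 hw
  exact Finset.mem_compl.2 (h.notMem_left C hC w hwC)

theorem card_le (h : IsTwoFactorBarrier G S T 𝒞) :
    S.card + T.card + ∑ C ∈ 𝒞, C.card ≤ Fintype.card V := by
  have h1 : ∑ C ∈ 𝒞, C.card = (𝒞.biUnion id).card :=
    (Finset.card_biUnion h.pairwiseDisjoint).symm
  rw [h1, ← Finset.card_union_of_disjoint h.disjoint, ← Finset.card_union_of_disjoint]
  · exact Finset.card_le_univ _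
  · rw [Finset.disjoint_right]
    intro v hv hv'
    obtain ⟨C, hC, hvC⟩ := Finset.mem_biUnion.1 hv
    rcases Finset.mem_union.1 hv' with hv' | hv'
    · exact h.notMem_left C hC v hvC hv'
    · exact h.notMem_right C hC v hvC hv'

theorem degree_le (h : IsTwoFactorBarrier G S T 𝒞) {C : Finset V} (hC : C ∈ 𝒞) {v : V}
    (hv : v ∈ C) : nb G v Finset.univ + 1 ≤ S.card + C.card + nb G v T := by
  classical
  have h1 : nb G v Finset.univ ≤ nb G v ((S ∪ C.erase v) ∪ T) := by
    refine Finset.card_le_card fun w hw => ?_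
    have hvw := (Finset.mem_filter.1 hw).2
    refine Finset.mem_filter.2 ⟨?_, hvw⟩
    by_cases hwS : w ∈ S
    · simp [hwS]
    by_cases hwT : w ∈ T
    · simp [hwT]
    simp [h.closed C hC v hv w hvw hwS hwT, hvw.ne']
  have h2 := nb_union_le G v (S ∪ C.erase v) T
  have h3 := nb_le_card G v (S ∪ C.erase v)
  have h4 := Finset.card_union_le S (C.erase v)
  have h5 := Finset.card_erase_add_one hv
  omega

/-- A vertex of T with at most y neighbors outside S has degree at most |S| + y. As T is disjoint
from the sets of 𝒞, both kinds of vertices count separately as low. -/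
theorem le_lowCount (h : IsTwoFactorBarrier G S T 𝒞) {𝒞' : Finset (Finset V)} (h' : 𝒞' ⊆ 𝒞)
    (y : ℕ) : T.card + ∑ C ∈ 𝒞', (C.filter fun v => nb G v Finset.univ ≤ S.card + y).card ≤
      lowCount G (S.card + y) + (T.filter fun v => y < nb G v Sᶜ).card := by
  have h1 := Finset.card_filter_add_card_filter_not (s := T) (fun v => y < nb G v Sᶜ)
  have h2 : ∑ C ∈ 𝒞', (C.filter fun v => nb G v Finset.univ ≤ S.card + y).card =
      (𝒞'.biUnion fun C => C.filter fun v => nb G v Finset.univ ≤ S.card + y).card := by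
    rw [Finset.card_biUnion]
    intro C hC C' hC' hne
    exact Finset.disjoint_filter_filter (h.pairwiseDisjoint (h' hC) (h' hC') hne)
  have h3 : (T.filter fun v => ¬ y < nb G v Sᶜ).card +
      (𝒞'.biUnion fun C => C.filter fun v => nb G v Finset.univ ≤ S.card + y).card ≤
      lowCount G (S.card + y) := by
    rw [← Finset.card_union_of_disjoint]
    · refine Finset.card_le_card fun v hv => ?_
      simp only [Finset.mem_filter, Finset.mem_univ, true_and]
      rcases Finset.mem_union.1 hv with hv | hv
      · have := (Finset.mem_filter.1 hv).2
        have := nb_univ_eq G v S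
        have := nb_le_card G v S
        omega
      · obtain ⟨C, -, hvC⟩ := Finset.mem_biUnion.1 hv
        exact (Finset.mem_filter.1 hvC).2
    · rw [Finset.disjoint_left]
      intro v hv hv'
      obtain ⟨C, hC, hvC⟩ := Finset.mem_biUnion.1 hv'
      exact h.notMem_right C (h' hC) v (Finset.mem_filter.1 hvC).1 (Finset.mem_filter.1 hv).1
  omega

end IsTwoFactorBarrier

theorem card_filter_add_le_sum {V : Type*} (T : Finset V) (e : V → ℕ) {a : ℕ} (ha : 2 ≤ a) :
    (T.filter fun v => 0 < e v).card + (T.filter fun v => 1 < e v).card +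
      (T.filter fun v => a < e v).card ≤ ∑ v ∈ T, e v := by
  simp only [Finset.card_filter, ← Finset.sum_add_distrib]
  refine Finset.sum_le_sum fun v _ => ?_
  split_ifs <;> omega

/-- A graph without a `2`-factor has many vertices of small degree. -/
theorem exists_low_degrees_of_not_hasTwoFactor {V : Type*} [Fintype V] [DecidableEq V]
    {G : SimpleGraph V} (hn : 3 ≤ Fintype.card V) (hG : ¬ HasTwoFactor G) :
    ∃ D, 2 * D + 1 ≤ Fintype.card V ∧ D ≤ lowCount G D ∧ D + 1 ≤ lowCount G (D + 1) ∧
      (2 * D + 1 = Fintype.card V → D + 1 ≤ lowCount G D) := by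
  classical
  by_contra hcon
  push Not at hcon
  -- The negated claim amounts to two upper bounds on the number of low degrees: this one, and the
  -- sharper `F2` for D + 1 when there are already D vertices of degree at most D.
  have F1 : ∀ D, 2 * D + 1 ≤ Fintype.card V → lowCount G D ≤ D := by
    intro D hD
    by_contra hlt
    have := hcon D hD (by omega) (by have := lowCount_mono G (Nat.le_add_right D 1); omega)
    omega
  have F2 : ∀ D, 2 * D + 2 ≤ Fintype.card V → D ≤ lowCount G D → lowCount G (D + 1) ≤ D := by
    intro D hD h1
    by_contra hlt
    have := hcon D (by omega) h1 (by omega)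
    omega
  have hdeg : ∀ v, ∃ w, G.Adj v w := by
    intro v
    by_contra hv
    push Not at hv
    have h0 := F1 0 (by omega)
    have : 0 < lowCount G 0 := Finset.card_pos.2 ⟨v, by simp [nb, hv]⟩
    omega
  obtain ⟨S₀, T₀, 𝒞₀, h₀⟩ := exists_isTwoFactorBarrier hG hdeg
  obtain ⟨S, T, 𝒞, h, hsing⟩ := h₀.exists_singletons
  have hE := h.sum_edges_le
  have hcard := h.card_le
  have hdef := h.deficient
  have hb := fun a (ha : 2 ≤ a) => card_filter_add_le_sum T (fun v => nb G v Sᶜ) ha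
  have hk0 := h.le_lowCount (Finset.empty_subset 𝒞) 0
  have hk1 := h.le_lowCount (Finset.empty_subset 𝒞) 1
  rw [Finset.sum_empty, add_zero] at hk0 hk1
  set E := ∑ v ∈ T, nb G v Sᶜ with hEdef
  set b₀ := (T.filter fun v => 0 < nb G v Sᶜ).card with hb₀
  set b₁ := (T.filter fun v => 1 < nb G v Sᶜ).card with hb₁
  have hb2 := hb 2 le_rfl
  have hb0T : b₀ ≤ T.card := Finset.card_filter_le _ _
  have hγ : ∀ C ∈ 𝒞, 1 ≤ ∑ v ∈ C, nb G v T := fun C hC => (h.odd C hC).pos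
  have hpos : ∀ C ∈ 𝒞, 1 ≤ C.card := fun C hC => (h.nonempty hC).card_pos
  have hqE : 𝒞.card ≤ E := by
    refine le_trans ?_ hE
    rw [Finset.card_eq_sum_ones]
    exact Finset.sum_le_sum hγ
  have hqcard : 𝒞.card ≤ ∑ C ∈ 𝒞, C.card := by
    rw [Finset.card_eq_sum_ones]
    exact Finset.sum_le_sum hpos
  simp only [add_zero] at hk0
  have hn2 : 2 * S.card + 2 ≤ Fintype.card V := by
    by_contra hlt
    have := F1 S.card (by omega)
    omega
  -- The sum of the bounds on |T| obtained from degrees at most |S| and at most |S| + 1. With `hb2`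
  -- and the deficiency it shows that 𝒞 has at least two sets.
  have hb01 : 2 * T.card ≤ b₀ + b₁ + 2 * S.card := by
    have f1 := F1 S.card (by omega)
    by_cases hs : S.card ≤ lowCount G S.card
    · have f2 := F2 S.card hn2 hs
      omega
    · by_cases hn3 : 2 * (S.card + 1) + 1 ≤ Fintype.card V
      · have f1' := F1 (S.card + 1) hn3
        omega
      · omega
  have hq : 2 ≤ 𝒞.card := by omega
  obtain ⟨C₀, hC₀, hmax₀⟩ := Finset.exists_max_image 𝒞 Finset.card
    (Finset.card_pos.1 (by omega))
  have hcard' := Finset.card_erase_of_mem hC₀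
  obtain ⟨C₁, hC₁, hmax₁⟩ := Finset.exists_max_image (𝒞.erase C₀) Finset.card
    (Finset.card_pos.1 (by omega))
  have hsub := Finset.erase_subset C₀ 𝒞
  have hμ₀ := hmax₀ C₁ (hsub hC₁)
  have hμ := hpos C₁ (hsub hC₁)
  have hM : ∑ C ∈ 𝒞.erase C₀, C.card + C₀.card = ∑ C ∈ 𝒞, C.card :=
    Finset.sum_erase_add _ _ hC₀
  have hM' : C₁.card + (𝒞.card - 2) ≤ ∑ C ∈ 𝒞.erase C₀, C.card := by
    rw [← Finset.add_sum_erase _ _ hC₁]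
    have : ((𝒞.erase C₀).erase C₁).card ≤ ∑ C ∈ (𝒞.erase C₀).erase C₁, C.card := by
      rw [Finset.card_eq_sum_ones]
      exact Finset.sum_le_sum fun C hC => hpos C (hsub (Finset.mem_of_mem_erase hC))
    have := Finset.card_erase_of_mem hC₁
    omega
  have hE' : ∑ C ∈ 𝒞.erase C₀, ∑ v ∈ C, nb G v T + 1 ≤ E := by
    have := Finset.sum_erase_add 𝒞 (fun C => ∑ v ∈ C, nb G v T) hC₀
    have := hγ C₀ hC₀
    omega
  -- C₁ is largest among the sets other than C₀. In those sets a vertex with at most one neighbor in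
  -- T has degree at most |S| + |C₁|, and there are too many such vertices for `F1`.
  by_cases hμ2 : 2 ≤ C₁.card
  · have hk := h.le_lowCount hsub C₁.card
    have f1 := F1 (S.card + C₁.card) (by omega)
    have hbμ := hb _ hμ2
    have hsplit : ∀ C ∈ 𝒞.erase C₀, C.card ≤
        (C.filter fun v => nb G v Finset.univ ≤ S.card + C₁.card).card +
          (C.filter fun v => 2 ≤ nb G v T).card := by
      intro C hC
      rw [← Finset.card_filter_add_card_filter_not (s := C)
        (fun v => nb G v Finset.univ ≤ S.card + C₁.card)]
      refine Nat.add_le_add_left (Finset.card_le_card fun v hv => ?_) _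
      obtain ⟨hvC, hv⟩ := Finset.mem_filter.1 hv
      have := h.degree_le (hsub hC) hvC
      have := hmax₁ C hC
      exact Finset.mem_filter.2 ⟨hvC, by omega⟩
    -- The extra 1 comes from the odd number of edges between C and T.
    have hg : ∀ C ∈ 𝒞.erase C₀, 2 * (C.filter fun v => 2 ≤ nb G v T).card + 1 ≤
        ∑ v ∈ C, nb G v T := by
      intro C hC
      have h1 : 2 * (C.filter fun v => 2 ≤ nb G v T).card ≤ ∑ v ∈ C, nb G v T := by
        rw [Finset.card_filter, Finset.mul_sum]
        refine Finset.sum_le_sum fun v _ => ?_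
        split_ifs <;> omega
      obtain ⟨m, hm⟩ := h.odd C (hsub hC)
      omega
    have s1 := Finset.sum_le_sum hsplit
    have s2 := Finset.sum_le_sum hg
    rw [Finset.sum_add_distrib] at s1 s2
    rw [← Finset.mul_sum, Finset.sum_const, smul_eq_mul, mul_one] at s2
    omega
  -- Now all sets except C₀ are singletons, whose vertex has exactly one neighbor in T and hence
  -- degree at most |S| + 1.
  · have hk := h.le_lowCount hsub 1
    have hone : ∀ C ∈ 𝒞.erase C₀,
        1 ≤ (C.filter fun v => nb G v Finset.univ ≤ S.card + 1).card := by
      intro C hC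
      have h1 := hmax₁ C hC
      have h2 := hpos C (hsub hC)
      obtain ⟨y, rfl⟩ := Finset.card_eq_one.1 (show C.card = 1 by omega)
      have h3 := hsing y (hsub hC)
      have h4 := h.degree_le (hsub hC) (Finset.mem_singleton_self y)
      exact Finset.card_pos.2 ⟨y, Finset.mem_filter.2 ⟨Finset.mem_singleton_self y, by
        rw [Finset.card_singleton] at h4
        omega⟩⟩
    have s1 := Finset.sum_le_sum hone
    rw [Finset.sum_const, smul_eq_mul, mul_one] at s1
    have f1 := F1 S.card (by omega)
    have f1' := F1 (S.card + 1) (by omega)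
    by_cases hs : S.card ≤ lowCount G S.card
    · have f2 := F2 S.card hn2 hs
      omega
    · omega

/-! ### Degrees in non-Hamiltonian graphs -/

/-- `p 0, …, p (n - 1)` is a Hamiltonian cycle, `n` being the number of vertices. -/
def HasHamiltonianCycle {V : Type*} [Fintype V] (G : SimpleGraph V) : Prop :=
  ∃ p : ℕ → V, (∀ i < Fintype.card V, ∀ j < Fintype.card V, p i = p j → i = j) ∧
    (∀ i, i + 1 < Fintype.card V → G.Adj (p i) (p (i + 1))) ∧ G.Adj (p (Fintype.card V - 1)) (p 0)

section Hamiltonian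

variable {V : Type*} [Fintype V] {G : SimpleGraph V}

theorem exists_lt_card_of_injOn {p : ℕ → V}
    (hp : ∀ i < Fintype.card V, ∀ j < Fintype.card V, p i = p j → i = j) (v : V) :
    ∃ i < Fintype.card V, p i = v := by
  classical
  have h : ((Finset.range (Fintype.card V)).image p) = Finset.univ := by
    refine Finset.eq_univ_of_card _ ?_
    rw [Finset.card_image_of_injOn, Finset.card_range]
    intro i hi j hj hij
    exact hp i (by simpa using hi) j (by simpa using hj) hij
  have := Finset.mem_univ v
  rw [← h] at this
  simpa using this

/-- The crossing argument: the degrees of the ends of a Hamiltonian path. -/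
theorem nb_add_nb_lt (hn : 3 ≤ Fintype.card V) (hG : ¬ HasHamiltonianCycle G) {q : ℕ → V}
    (hq : ∀ i < Fintype.card V, ∀ j < Fintype.card V, q i = q j → i = j)
    (hadj : ∀ i, i + 1 < Fintype.card V → G.Adj (q i) (q (i + 1))) :
    nb G (q 0) Finset.univ + nb G (q (Fintype.card V - 1)) Finset.univ < Fintype.card V := by
  classical
  set n := Fintype.card V
  set A := (Finset.range (n - 1)).filter fun j => G.Adj (q 0) (q (j + 1)) with hA
  set B := (Finset.range (n - 1)).filter fun j => G.Adj (q (n - 1)) (q j) with hB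
  have hAcard : nb G (q 0) Finset.univ ≤ A.card := by
    refine le_trans (Finset.card_le_card (t := A.image fun j => q (j + 1)) ?_) Finset.card_image_le
    intro w hw
    have hw := (Finset.mem_filter.1 hw).2
    obtain ⟨i, hi, rfl⟩ := exists_lt_card_of_injOn hq w
    have hi0 : i ≠ 0 := by
      rintro rfl
      exact hw.ne rfl
    obtain ⟨j, rfl⟩ := Nat.exists_eq_succ_of_ne_zero hi0
    exact Finset.mem_image.2 ⟨j, Finset.mem_filter.2 ⟨Finset.mem_range.2 (by omega), hw⟩, rfl⟩
  have hBcard : nb G (q (n - 1)) Finset.univ ≤ B.card := by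
    refine le_trans (Finset.card_le_card (t := B.image q) ?_) Finset.card_image_le
    intro w hw
    have hw := (Finset.mem_filter.1 hw).2
    obtain ⟨i, hi, rfl⟩ := exists_lt_card_of_injOn hq w
    have hi0 : i ≠ n - 1 := by
      rintro rfl
      exact hw.ne rfl
    exact Finset.mem_image.2 ⟨i, Finset.mem_filter.2 ⟨Finset.mem_range.2 (by omega), hw⟩, rfl⟩
  have hdisj : Disjoint A B := by
    rw [Finset.disjoint_left]
    intro j hjA hjB
    obtain ⟨hj, h1⟩ := Finset.mem_filter.1 hjA
    obtain ⟨-, h2⟩ := Finset.mem_filter.1 hjB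
    have hj := Finset.mem_range.1 hj
    -- The path runs from q 0 to q j, jumps to q (n - 1) and returns down to q (j + 1), which is
    -- adjacent to q 0.
    refine hG ⟨fun i => if i ≤ j then q i else q (n + j - i), ?_, ?_, ?_⟩
    · intro a ha b hb hab
      simp only at hab
      split_ifs at hab with h h' h'
      · exact hq a ha b hb hab
      · have := hq a ha (n + j - b) (by omega) hab
        omega
      · have := hq (n + j - a) (by omega) b hb hab
        omega
      · have := hq (n + j - a) (by omega) (n + j - b) (by omega) hab
        omega
    · intro i hi
      simp only
      split_ifs with h h' h'
      · exact hadj i hi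
      · obtain rfl : i = j := by omega
        rw [show n + i - (i + 1) = n - 1 by omega]
        exact h2.symm
      · omega
      · have := hadj (n + j - (i + 1)) (by omega)
        rw [show n + j - (i + 1) + 1 = n + j - i by omega] at this
        exact this.symm
    · simp only
      rw [if_neg (by omega), if_pos (by omega), show n + j - (n - 1) = j + 1 by omega]
      exact h1.symm
  have hle : A.card + B.card ≤ n - 1 := by
    rw [← Finset.card_union_of_disjoint hdisj]
    refine (Finset.card_le_card (Finset.union_subset (Finset.filter_subset _ _)
      (Finset.filter_subset _ _))).trans ?_
    simp
  omega

/-- A Hamiltonian cycle of the enlarged graph must use the new edge. Rotating the cycle so that this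
edge closes it leaves a Hamiltonian path of G between u and v. -/
theorem exists_hamiltonian_path (hn : 3 ≤ Fintype.card V) (hG : ¬ HasHamiltonianCycle G) {u v : V}
    (h : HasHamiltonianCycle (G ⊔ edge u v)) :
    ∃ q : ℕ → V, (∀ i < Fintype.card V, ∀ j < Fintype.card V, q i = q j → i = j) ∧
      (∀ i, i + 1 < Fintype.card V → G.Adj (q i) (q (i + 1))) ∧
      s(q (Fintype.card V - 1), q 0) = s(u, v) := by
  obtain ⟨p, hp, hadj, hclose⟩ := h
  set n := Fintype.card V
  have hn0 : 0 < n := by omega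
  set P : ℕ → V := fun m => p (m % n) with hP
  have hPinj : ∀ c, ∀ i < n, ∀ j < n, P (c + i) = P (c + j) → i = j := by
    intro c i hi j hj hij
    have h1 := hp _ (Nat.mod_lt _ hn0) _ (Nat.mod_lt _ hn0) hij
    have h2 : i ≡ j [MOD n] := Nat.ModEq.add_left_cancel' c h1
    exact Nat.ModEq.eq_of_lt_of_lt h2 hi hj
  have hPadj : ∀ m, (G ⊔ edge u v).Adj (P m) (P (m + 1)) := by
    intro m
    have hm := Nat.mod_lt m hn0
    simp only [hP]
    by_cases hlast : m % n = n - 1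
    · rw [Nat.add_mod, hlast, Nat.mod_eq_of_lt (show 1 < n by omega),
        show n - 1 + 1 = n by omega, Nat.mod_self]
      exact hclose
    · rw [Nat.add_mod, Nat.mod_eq_of_lt (show 1 < n by omega),
        Nat.mod_eq_of_lt (show m % n + 1 < n by omega)]
      exact hadj _ (by omega)
  have hPedge : ∀ m, ¬ G.Adj (P m) (P (m + 1)) → s(P m, P (m + 1)) = s(u, v) := by
    intro m hm
    have := hPadj m
    rw [sup_adj, edge_adj] at this
    rcases this with h | ⟨⟨h1, h2⟩ | ⟨h1, h2⟩, -⟩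
    · exact absurd h hm
    · rw [h1, h2]
    · rw [h1, h2, Sym2.eq_swap]
  have hPper : ∀ m, P (m + n) = P m := fun m => by simp [hP]
  obtain ⟨m, hm⟩ : ∃ m, ¬ G.Adj (P m) (P (m + 1)) := by
    by_contra hall
    push Not at hall
    refine hG ⟨P, ?_, fun i _ => hall i, ?_⟩
    · intro i hi j hj hij
      exact hPinj 0 i hi j hj (by simpa using hij)
    · have := hall (n - 1)
      rw [show n - 1 + 1 = 0 + n by omega, hPper] at this
      exact this
  refine ⟨fun j => P (m + 1 + j), hPinj (m + 1), ?_, ?_⟩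
  · intro i hi
    by_contra hcon
    have h1 := hPedge (m + 1 + i) (by simpa [add_assoc] using hcon)
    rw [← hPedge m hm, Sym2.eq_iff] at h1
    rcases h1 with ⟨h1, -⟩ | ⟨h1, h2⟩
    · have := hPinj m (1 + i) (by omega) 0 hn0 (by simpa [add_assoc] using h1)
      omega
    · have e1 := hPinj (m + 1) i (by omega) 0 hn0 (by simpa using h1)
      subst e1
      have := hPinj m 2 (by omega) 0 hn0 (by simpa using h2)
      omega
  · simp only
    rw [show m + 1 + (n - 1) = m + n by omega, hPper, add_zero]
    exact hPedge m hm

theorem hasHamiltonianCycle_top (hn : 3 ≤ Fintype.card V) :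
    HasHamiltonianCycle (⊤ : SimpleGraph V) := by
  set n := Fintype.card V with hnV
  have hn0 : 0 < n := by omega
  let e := (Fintype.equivFin V).symm
  have hinj : ∀ i < n, ∀ j < n, e ⟨i % n, Nat.mod_lt _ hn0⟩ = e ⟨j % n, Nat.mod_lt _ hn0⟩ →
      i = j := by
    intro i hi j hj hij
    have := Fin.ext_iff.1 (e.injective hij)
    simpa only [Nat.mod_eq_of_lt hi, Nat.mod_eq_of_lt hj] using this
  refine ⟨fun i => e ⟨i % n, Nat.mod_lt _ hn0⟩, hinj, ?_, ?_⟩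
  · intro i hi h
    have := hinj i (by omega) (i + 1) hi h
    omega
  · intro h
    have := hinj (n - 1) (by omega) 0 hn0 h
    omega

/-- A non-Hamiltonian graph has many vertices of small degree (Pósa, Chvátal). -/
theorem exists_low_degrees_of_not_hasHamiltonianCycle (hn : 3 ≤ Fintype.card V)
    (hG : ¬ HasHamiltonianCycle G) :
    ∃ D, 1 ≤ D ∧ 2 * D + 1 ≤ Fintype.card V ∧ D ≤ lowCount G D ∧
      (2 * D + 1 = Fintype.card V → D + 1 ≤ lowCount G D) := by
  classical
  -- Adding edges only raises degrees, so low degrees found in an edge-maximal non-Hamiltonian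
  -- supergraph are also low in G.
  obtain ⟨H, hGH, hHmax⟩ := (Set.toFinite {H : SimpleGraph V | ¬ HasHamiltonianCycle H}).exists_le_maximal hG
  have hH : ¬ HasHamiltonianCycle H := hHmax.1
  have hmono : ∀ D, lowCount H D ≤ lowCount G D := by
    intro D
    refine Finset.card_le_card fun v hv => ?_
    have hv := (Finset.mem_filter.1 hv).2
    refine Finset.mem_filter.2 ⟨Finset.mem_univ _, le_trans ?_ hv⟩
    exact Finset.card_le_card (Finset.monotone_filter_right _ fun w _ hw => hGH hw)
  suffices ∃ D, 1 ≤ D ∧ 2 * D + 1 ≤ Fintype.card V ∧ D ≤ lowCount H D ∧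
      (2 * D + 1 = Fintype.card V → D + 1 ≤ lowCount H D) by
    obtain ⟨D, h1, h2, h3, h4⟩ := this
    have := hmono D
    exact ⟨D, h1, h2, by omega, fun h => by have := h4 h; omega⟩
  have hne : ∃ u v, u ≠ v ∧ ¬ H.Adj u v := by
    by_contra hcon
    push Not at hcon
    refine hH ?_
    have : H = ⊤ := by
      ext u v
      exact ⟨fun h => h.ne, fun h => hcon u v h⟩
    rw [this]
    exact hasHamiltonianCycle_top hn
  obtain ⟨u₀, v₀, hne₀, hadj₀⟩ := hne
  -- For a nonadjacent pair of maximal degree sum with deg u ≤ deg v, every nonneighbor of v has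
  -- degree at most deg u. There are at least deg u of them because deg u + deg v < n, so D = deg u
  -- works.
  obtain ⟨⟨u, v⟩, hmem, hmax⟩ := Finset.exists_max_image
    (Finset.univ.filter fun p : V × V => p.1 ≠ p.2 ∧ ¬ H.Adj p.1 p.2)
    (fun p => nb H p.1 Finset.univ + nb H p.2 Finset.univ) ⟨(u₀, v₀), by simp [hne₀, hadj₀]⟩
  simp only [Finset.mem_filter, Finset.mem_univ, true_and] at hmem hmax
  obtain ⟨huv, hnadj⟩ := hmem
  replace hmax : ∀ a b, a ≠ b → ¬ H.Adj a b →
      nb H a Finset.univ + nb H b Finset.univ ≤ nb H u Finset.univ + nb H v Finset.univ :=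
    fun a b hab h => hmax (a, b) ⟨hab, h⟩
  clear hne₀ hadj₀
  wlog hle : nb H u Finset.univ ≤ nb H v Finset.univ generalizing u v
  · exact this v u huv.symm (fun h => hnadj h.symm) (fun a b hab h => by
      have := hmax a b hab h; omega) (by omega)
  have hham : HasHamiltonianCycle (H ⊔ edge u v) := by
    by_contra hcon
    have := hHmax.2 hcon le_sup_left
    exact hnadj (this (by simp [edge_adj, huv]))
  obtain ⟨q, hq, hqadj, hqe⟩ := exists_hamiltonian_path hn hH hham
  have hlt := nb_add_nb_lt hn hH hq hqadj
  have hsum : nb H u Finset.univ + nb H v Finset.univ < Fintype.card V := by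
    rw [Sym2.eq_iff] at hqe
    rcases hqe with ⟨h1, h2⟩ | ⟨h1, h2⟩
    · rw [h1, h2] at hlt
      omega
    · rw [h1, h2] at hlt
      omega
  set W := Finset.univ.filter fun w => w ≠ v ∧ ¬ H.Adj v w with hW
  have hWcard : W.card + nb H v Finset.univ + 1 = Fintype.card V := by
    have h1 := Finset.card_filter_add_card_filter_not (s := (Finset.univ : Finset V)) (fun w => H.Adj v w)
    have h2 : (Finset.univ.filter fun w => ¬ H.Adj v w) = insert v W := by
      ext w
      by_cases hw : w = v
      · simp [hw]
      · simp [hW, hw]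
    rw [h2, Finset.card_insert_of_notMem (by simp [hW]), Finset.card_univ] at h1
    unfold nb
    omega
  have hWlow : ∀ w ∈ W, nb H w Finset.univ ≤ nb H u Finset.univ := by
    intro w hw
    obtain ⟨-, hwv, hvw⟩ := Finset.mem_filter.1 hw
    have := hmax w v hwv fun h => hvw h.symm
    omega
  have hWlow' : ∀ D, nb H u Finset.univ ≤ D → W.card ≤ lowCount H D := fun D hD =>
    Finset.card_le_card fun w hw => Finset.mem_filter.2 ⟨Finset.mem_univ _, (hWlow w hw).trans hD⟩
  have hWlow'' : ∀ D, nb H u Finset.univ ≤ D → nb H v Finset.univ ≤ D →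
      W.card + 1 ≤ lowCount H D := by
    intro D hD hD'
    have hv : v ∉ W := by simp [hW]
    rw [← Finset.card_insert_of_notMem hv]
    refine Finset.card_le_card fun w hw => Finset.mem_filter.2 ⟨Finset.mem_univ _, ?_⟩
    rcases Finset.mem_insert.1 hw with rfl | hw
    · exact hD'
    · exact (hWlow w hw).trans hD
  have huW : u ∈ W := by simp [hW, huv, H.adj_comm v u, hnadj]
  have hWpos := Finset.card_pos.2 ⟨u, huW⟩
  -- D has to be positive; an isolated u is itself a witness for D = 1.
  by_cases h0 : nb H u Finset.univ = 0
  · refine ⟨1, le_rfl, by omega, ?_, fun h3 => ?_⟩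
    · have := hWlow' 1 (by omega)
      omega
    · have := hWlow'' 1 (by omega) (by omega)
      omega
  · refine ⟨nb H u Finset.univ, by omega, by omega, ?_, fun h3 => ?_⟩
    · have := hWlow' _ le_rfl
      omega
    -- For n = 2D + 1 also deg v ≤ D, so v is one more low vertex.
    · have := hWlow'' _ le_rfl (by omega)
      omega

end Hamiltonian

/-! ### Edges off a color and double counting -/

/-- The graph of the edges whose color is not `c`. -/
def offGraph {V : Type*} (φ : TopEdgeLabeling V ℕ) (c : ℕ) : SimpleGraph V where
  Adj u v := ∃ h : (⊤ : SimpleGraph V).Adj u v, φ.get u v h ≠ c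
  symm := ⟨fun u v ⟨h, hc⟩ => ⟨h.symm, by rwa [EdgeLabeling.get_comm]⟩⟩
  loopless := ⟨fun _ ⟨h, _⟩ => h.ne rfl⟩

theorem offGraph_apply_ne {V : Type*} {φ : TopEdgeLabeling V ℕ} {c : ℕ} (e : Sym2 V)
    (he : e ∈ (offGraph φ c).edgeSet) (he' : e ∈ (⊤ : SimpleGraph V).edgeSet) : φ ⟨e, he'⟩ ≠ c := by
  induction e using Sym2.ind with
  | _ u v =>
    obtain ⟨h, hc⟩ := (mem_edgeSet _).1 he
    exact hc

/-- No edge has both colors a and b, so every edge at v lies in at least one of the two graphs. -/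
theorem card_erase_le_nb_add_nb {V : Type*} [DecidableEq V] (φ : TopEdgeLabeling V ℕ) {a b : ℕ} (hab : a ≠ b)
    (v : V) (A : Finset V) :
    (A.erase v).card ≤ nb (offGraph φ a) v A + nb (offGraph φ b) v A := by
  classical
  unfold nb
  refine le_trans (Finset.card_le_card fun w hw => ?_) (Finset.card_union_le _ _)
  obtain ⟨hne, hw⟩ := Finset.mem_erase.1 hw
  by_cases hc : φ.get v w hne.symm = a
  · exact Finset.mem_union_right _ (Finset.mem_filter.2 ⟨hw, hne.symm, fun h => hab (hc.symm.trans h)⟩)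
  · exact Finset.mem_union_left _ (Finset.mem_filter.2 ⟨hw, hne.symm, hc⟩)

theorem card_mul_card_le {V : Type*} [DecidableEq V] (φ : TopEdgeLabeling V ℕ) {a b : ℕ} (hab : a ≠ b)
    {M M' : Finset V} (hM : Disjoint M M') :
    M.card * M'.card ≤ ∑ v ∈ M, nb (offGraph φ a) v M' + ∑ v ∈ M', nb (offGraph φ b) v M := by
  rw [sum_nb_comm _ M', ← Finset.sum_add_distrib, ← smul_eq_mul, ← Finset.sum_const]
  refine Finset.sum_le_sum fun v hv => ?_
  have := card_erase_le_nb_add_nb φ hab v M'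
  rwa [Finset.erase_eq_of_notMem (Finset.disjoint_left.1 hM hv)] at this

section

variable {V : Type*} [Fintype V] {φ : TopEdgeLabeling V ℕ}

theorem not_hasTwoFactor_offGraph (hφ : IsPolychromatic (twoRegularFamily V 0) φ) {c : ℕ}
    (hc : c ∈ Set.range φ) : ¬ HasTwoFactor (offGraph φ c) := by
  rintro ⟨H, hH, hdeg⟩
  obtain ⟨e, he, hec⟩ := hφ (SimpleGraph.toSubgraph H le_top)
    ⟨fun v _ => hdeg v, by
      simp [SimpleGraph.toSubgraph, Set.ncard_univ]⟩ c hc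
  refine offGraph_apply_ne e.1 ?_ e.2 hec
  obtain ⟨e, he'⟩ := e
  induction e using Sym2.ind with
  | _ u v => exact hH he

theorem isContained_of_hasHamiltonianCycle {G : SimpleGraph V} (h : HasHamiltonianCycle G) :
    cycleGraph (Fintype.card V) ⊑ G := by
  obtain ⟨p, hp, hadj, hclose⟩ := h
  have key : ∀ a b : Fin (Fintype.card V), (a - b).val = 1 → G.Adj (p a) (p b) := by
    intro a b hab
    have ha := a.2
    have hb := b.2
    rw [Fin.sub_def] at hab
    simp only at hab
    by_cases hlt : b.1 < a.1
    · rw [show Fintype.card V - b.1 + a.1 = (a.1 - b.1) + Fintype.card V by omega,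
        Nat.add_mod_right, Nat.mod_eq_of_lt (by omega)] at hab
      have := hadj b.1 (by omega)
      rw [show b.1 + 1 = a.1 by omega] at this
      exact this.symm
    · by_cases heq : a.1 = b.1
      · rw [show Fintype.card V - b.1 + a.1 = Fintype.card V by omega, Nat.mod_self] at hab
        omega
      · rw [Nat.mod_eq_of_lt (by omega)] at hab
        rw [show a.1 = 0 by omega, show b.1 = Fintype.card V - 1 by omega]
        exact hclose.symm
  refine ⟨⟨⟨fun i => p i, ?_⟩, ?_⟩⟩
  · intro a b hab
    rcases cycleGraph_adj'.1 hab with h | h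
    · exact key a b h
    · exact (key b a h).symm
  · intro a b hab
    exact Fin.ext (hp a a.2 b b.2 hab)

theorem not_hasHamiltonianCycle_offGraph (hn : 3 ≤ Fintype.card V)
    (hφ : IsPolychromatic (cycleFamily V 0) φ) {c : ℕ}
    (hc : c ∈ Set.range φ) : ¬ HasHamiltonianCycle (offGraph φ c) := by
  intro h
  obtain ⟨v, w, hw, hlen⟩ := (cycleGraph_isContained_iff (by omega)).1
    (isContained_of_hasHamiltonianCycle h)
  obtain ⟨e, he, hec⟩ := hφ (w.mapLe le_top).toSubgraph
    ⟨v, w.mapLe le_top, hw.mapLe le_top, by simp [hlen], rfl⟩ c hc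
  refine offGraph_apply_ne e.1 ?_ e.2 hec
  rw [Walk.mem_edges_toSubgraph, Walk.edges_mapLe_eq_edges] at he
  exact w.edges_subset_edgeSet he

theorem cycleFamily_spec {H : (⊤ : SimpleGraph V).Subgraph} (hH : H ∈ cycleFamily V 0) :
    H.Connected ∧ (∀ v, v ∈ H.verts) ∧ ∀ v, (H.neighborSet v).ncard = 2 := by
  classical
  obtain ⟨v, w, hw, hlen, rfl⟩ := hH
  have hham : w.IsHamiltonianCycle := by
    rw [Walk.isHamiltonianCycle_iff_isCycle_and_length_eq]
    exact ⟨hw, by simpa [Nat.card_eq_fintype_card] using hlen⟩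
  exact ⟨w.toSubgraph_connected, fun u => w.mem_verts_toSubgraph.2 (hham.mem_support u),
    fun u => hw.ncard_neighborSet_toSubgraph_eq_two (hham.mem_support u)⟩

theorem cycleFamily_subset : cycleFamily V 0 ⊆ twoRegularFamily V 0 := by
  intro H hH
  obtain ⟨-, h1, h2⟩ := cycleFamily_spec hH
  refine ⟨fun v _ => h2 v, ?_⟩
  rw [Set.eq_univ_of_forall h1, Set.ncard_univ]
  simp

theorem card_le_nb_add_nb [DecidableEq V] (φ : TopEdgeLabeling V ℕ) {a b : ℕ} (hab : a ≠ b) (v : V) :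
    Fintype.card V ≤
      nb (offGraph φ a) v Finset.univ + nb (offGraph φ b) v Finset.univ + 1 := by
  have h1 := card_erase_le_nb_add_nb φ hab v Finset.univ
  rw [Finset.card_erase_of_mem (Finset.mem_univ v), Finset.card_univ] at h1
  omega

/-- Double counting of the edges between disjoint vertex classes `M a`, one for each color `a`. -/
theorem sq_sum_card_le [DecidableEq V] (φ : TopEdgeLabeling V ℕ) (J : Finset ℕ) (M : ℕ → Finset V)
    (hM : ∀ a ∈ J, ∀ b ∈ J, a ≠ b → Disjoint (M a) (M b)) (B : ℕ → ℕ)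
    (hB : ∀ a ∈ J, ∑ v ∈ M a, nb (offGraph φ a) v Finset.univ ≤ B a) :
    (∑ a ∈ J, (M a).card) ^ 2 ≤ ∑ a ∈ J, (M a).card ^ 2 + 2 * ∑ a ∈ J, B a := by
  classical
  set X : ℕ → ℕ → ℕ := fun a b => ∑ v ∈ M a, nb (offGraph φ a) v (M b) with hX
  have hrow : ∀ a ∈ J, ∑ b ∈ J.erase a, X a b ≤ B a := by
    intro a ha
    refine le_trans ?_ (hB a ha)
    simp only [hX]
    rw [Finset.sum_comm]
    refine Finset.sum_le_sum fun v _ => ?_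
    unfold nb
    rw [← Finset.card_biUnion]
    · exact Finset.card_le_card fun w hw => by
        obtain ⟨b, -, hw⟩ := Finset.mem_biUnion.1 hw
        exact Finset.mem_filter.2 ⟨Finset.mem_univ _, (Finset.mem_filter.1 hw).2⟩
    · intro b hb b' hb' hne
      exact Finset.disjoint_filter_filter (hM b (Finset.mem_of_mem_erase hb) b'
        (Finset.mem_of_mem_erase hb') hne)
  have hswap : ∑ a ∈ J, ∑ b ∈ J.erase a, X b a = ∑ a ∈ J, ∑ b ∈ J.erase a, X a b := by
    refine Finset.sum_comm' fun a b => ?_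
    simp only [Finset.mem_erase]
    grind
  calc (∑ a ∈ J, (M a).card) ^ 2
      = ∑ a ∈ J, ∑ b ∈ J, (M a).card * (M b).card := by rw [sq, Finset.sum_mul_sum]
    _ = ∑ a ∈ J, ((M a).card ^ 2 + ∑ b ∈ J.erase a, (M a).card * (M b).card) := by
        refine Finset.sum_congr rfl fun a ha => ?_
        rw [← Finset.add_sum_erase _ _ ha, sq]
    _ ≤ ∑ a ∈ J, ((M a).card ^ 2 + ∑ b ∈ J.erase a, (X a b + X b a)) := by
        refine Finset.sum_le_sum fun a ha => Nat.add_le_add_left (Finset.sum_le_sum fun b hb => ?_) _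
        obtain ⟨hne, hb⟩ := Finset.mem_erase.1 hb
        exact card_mul_card_le φ hne.symm (hM a ha b hb hne.symm)
    _ = ∑ a ∈ J, (M a).card ^ 2 + 2 * ∑ a ∈ J, ∑ b ∈ J.erase a, X a b := by
        simp only [Finset.sum_add_distrib]
        rw [hswap, two_mul]
    _ ≤ _ := by
        gcongr with a ha
        exact hrow a ha

end

/-! ### Upper bounds on the number of colors -/

theorem exists_sorted (C : Finset ℕ) (d : ℕ → ℕ) :
    ∃ c : ℕ → ℕ, (∀ i < C.card, c i ∈ C) ∧ (∀ i < C.card, ∀ j < C.card, c i = c j → i = j) ∧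
      ∀ i j, i ≤ j → j < C.card → d (c i) ≤ d (c j) := by
  let e := C.equivFin.symm
  let f : Fin C.card → ℕ := fun i => d (e i)
  have hf := Tuple.monotone_sort f
  refine ⟨fun i => if h : i < C.card then e (Tuple.sort f ⟨i, h⟩) else 0, ?_, ?_, ?_⟩
  · intro i hi
    simp only [hi, dif_pos]
    exact (e _).2
  · intro i hi j hj hij
    simp only [hi, hj, dif_pos] at hij
    have := (Tuple.sort f).injective (e.injective (Subtype.ext hij))
    exact Fin.ext_iff.1 this
  · intro i j hij hj
    have hi : i < C.card := by omega
    simp only [hi, hj, dif_pos]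
    exact hf (show (⟨i, hi⟩ : Fin C.card) ≤ ⟨j, hj⟩ from hij)

/-- When the colors are sorted by d, initial segments are sets of colors, so inequalities over all
subsets become the hypothesis of the growth lemmas. -/
theorem exists_large_of_subset_sums {C : Finset ℕ} {d : ℕ → ℕ} {F : ℤ → ℤ} {t : ℕ}
    (hgrow : ∀ x : ℕ → ℤ, (∀ i < C.card, 0 < x i) → (∀ i j, i ≤ j → j < C.card → x i ≤ x j) →
      (∀ j ≤ C.card, (∑ i ∈ Finset.range j, x i) ^ 2 ≤ ∑ i ∈ Finset.range j, F (x i)) →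
      (t : ℤ) ≤ x (C.card - 1))
    (hC : 0 < C.card) (hpos : ∀ a ∈ C, 0 < d a)
    (hsum : ∀ J ⊆ C, (∑ a ∈ J, (d a : ℤ)) ^ 2 ≤ ∑ a ∈ J, F (d a)) : ∃ a ∈ C, t ≤ d a := by
  obtain ⟨c, hcC, hinj, hmono⟩ := exists_sorted C d
  refine ⟨c (C.card - 1), hcC _ (by omega), ?_⟩
  have := hgrow (fun i => d (c i)) (fun i hi => by exact_mod_cast hpos _ (hcC i hi))
    (fun i j hij hj => by exact_mod_cast hmono i j hij hj) ?_
  · exact_mod_cast this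
  · intro j hj
    have hi : Set.InjOn c (Finset.range j) := fun a ha b hb h =>
      hinj a (by simp at ha; omega) b (by simp at hb; omega) h
    have := hsum ((Finset.range j).image c) fun a ha => by
      obtain ⟨i, hi, rfl⟩ := Finset.mem_image.1 ha
      exact hcC i (by simp at hi; omega)
    rwa [Finset.sum_image hi, Finset.sum_image hi] at this

section

variable {V : Type*} [Fintype V]

/-- The vertices at which at most `D` edges have a color other than `a`. -/
noncomputable def lowVerts (φ : TopEdgeLabeling V ℕ) (a D : ℕ) : Finset V :=
  Finset.univ.filter fun v => nb (offGraph φ a) v Finset.univ ≤ D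

theorem mem_lowVerts {φ : TopEdgeLabeling V ℕ} {a D : ℕ} {v : V} :
    v ∈ lowVerts φ a D ↔ nb (offGraph φ a) v Finset.univ ≤ D := by
  simp [lowVerts]

/-- Many vertices have few edges of colors other than `a`: Pósa's condition for the graph of the
edges whose color is not `a` fails at `D`. -/
structure IsLow (φ : TopEdgeLabeling V ℕ) (a D : ℕ) : Prop where
  pos : 1 ≤ D
  two_mul_lt : 2 * D + 1 ≤ Fintype.card V
  le_card : D ≤ (lowVerts φ a D).card
  lt_card : 2 * D + 1 = Fintype.card V → D + 1 ≤ (lowVerts φ a D).card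

theorem disjoint_lowVerts [DecidableEq V] (φ : TopEdgeLabeling V ℕ) {a b D D' : ℕ} (hab : a ≠ b)
    (h : D + D' + 1 < Fintype.card V) : Disjoint (lowVerts φ a D) (lowVerts φ b D') := by
  refine Finset.disjoint_left.2 fun v hv hv' => ?_
  have := card_le_nb_add_nb φ hab v
  rw [mem_lowVerts] at hv hv'
  omega

/-- Every edge at v is off a or off b, and an edge of a third color is off both. If the two counts
add up to at most n - 1, nothing is counted twice. -/
theorem get_eq_or_eq [DecidableEq V] (φ : TopEdgeLabeling V ℕ) {a b : ℕ} (hab : a ≠ b) {v w : V}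
    (h : nb (offGraph φ a) v Finset.univ + nb (offGraph φ b) v Finset.univ + 1 ≤ Fintype.card V)
    (hvw : (⊤ : SimpleGraph V).Adj v w) : φ.get v w hvw = a ∨ φ.get v w hvw = b := by
  classical
  by_contra! hne
  have h1 := card_erase_le_nb_add_nb φ hab v (Finset.univ.erase w)
  rw [Finset.card_erase_of_mem (by simpa using hvw.ne), Finset.card_erase_of_mem (by simp),
    Finset.card_univ] at h1
  have h2 : ∀ c, φ.get v w hvw ≠ c →
      nb (offGraph φ c) v (Finset.univ.erase w) + 1 ≤ nb (offGraph φ c) v Finset.univ := by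
    intro c hc
    unfold nb
    rw [← Finset.card_insert_of_notMem (a := w) (by simp)]
    refine Finset.card_le_card fun x hx => ?_
    simp only [Finset.mem_insert, Finset.mem_filter, Finset.mem_univ, true_and] at hx ⊢
    obtain rfl | hx := hx
    · exact ⟨hvw, hc⟩
    · exact hx.2
  have := h2 a hne.1
  have := h2 b hne.2
  omega

/-- Low sets of two colors with 2D + 1 = n intersect, and a vertex in both sees only these two
colors. If all colors are of this kind, two disjoint pairs of colors give vertices u and v that
clash on the edge uv, or at once if u = v. If some color a is not, its low set avoids those of c and
e. The latter then share more than `d a` vertices, and these send edges of color c or e to a low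
vertex of a. -/
theorem eq_of_isLow_of_isLow [DecidableEq V] {φ : TopEdgeLabeling V ℕ} {C : Finset ℕ} {d : ℕ → ℕ}
    (hC : 4 ≤ C.card) (hd : ∀ a ∈ C, IsLow φ a (d a)) {c e : ℕ} (hc : c ∈ C) (he : e ∈ C)
    (hdc : 2 * d c + 1 = Fintype.card V) (hde : 2 * d e + 1 = Fintype.card V) : c = e := by
  classical
  by_contra hce
  have hinter : ∀ a ∈ C, ∀ b ∈ C, 2 * d a + 1 = Fintype.card V → 2 * d b + 1 = Fintype.card V →
      (lowVerts φ a (d a) ∪ lowVerts φ b (d b)).card + (lowVerts φ a (d a) ∩ lowVerts φ b (d b)).card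
        ≥ Fintype.card V + 1 := by
    intro a ha b hb ha' hb'
    rw [Finset.card_union_add_card_inter]
    have := (hd a ha).lt_card ha'
    have := (hd b hb).lt_card hb'
    omega
  have hget : ∀ a ∈ C, ∀ b ∈ C, 2 * d a + 1 = Fintype.card V → 2 * d b + 1 = Fintype.card V →
      ∀ v ∈ lowVerts φ a (d a) ∩ lowVerts φ b (d b), ∀ w (h : (⊤ : SimpleGraph V).Adj v w),
      a ≠ b → φ.get v w h = a ∨ φ.get v w h = b := by
    intro a ha b hb ha' hb' v hv w h hab
    obtain ⟨h1, h2⟩ := Finset.mem_inter.1 hv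
    rw [mem_lowVerts] at h1 h2
    exact get_eq_or_eq φ hab (by omega) h
  obtain hall | ⟨a, ha, hac, hae, hlt⟩ :
      (∀ a ∈ C, a ≠ c → a ≠ e → 2 * d a + 1 = Fintype.card V) ∨
      ∃ a ∈ C, a ≠ c ∧ a ≠ e ∧ 2 * d a + 1 ≠ Fintype.card V := by
    by_contra! hcon
    obtain ⟨⟨a, ha, h1, h2, h3⟩, h4⟩ := hcon
    exact h3 (h4 a ha h1 h2)
  · have h2 : 1 < ((C.erase c).erase e).card := by
      rw [Finset.card_erase_of_mem (Finset.mem_erase.2 ⟨Ne.symm hce, he⟩),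
        Finset.card_erase_of_mem hc]
      omega
    obtain ⟨a, ha, b, hb, hab⟩ := Finset.one_lt_card.1 h2
    simp only [Finset.mem_erase] at ha hb
    have ha' := hall a ha.2.2 ha.2.1 ha.1
    have hb' := hall b hb.2.2 hb.2.1 hb.1
    have hne : ∀ a ∈ C, ∀ b ∈ C, 2 * d a + 1 = Fintype.card V → 2 * d b + 1 = Fintype.card V →
      (lowVerts φ a (d a) ∩ lowVerts φ b (d b)).Nonempty := by
      intro a ha b hb ha' hb'
      have h1 := hinter a ha b hb ha' hb'
      have h2 := (lowVerts φ a (d a) ∪ lowVerts φ b (d b)).card_le_univ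
      exact Finset.card_pos.1 (by omega)
    obtain ⟨u, hu⟩ := hne a ha.2.2 b hb.2.2 ha' hb'
    obtain ⟨v, hv⟩ := hne c hc e he hdc hde
    by_cases huv : u = v
    · subst huv
      have : 1 < Fintype.card V := by have := (hd c hc).pos; omega
      obtain ⟨w, hw⟩ := Fintype.exists_ne_of_one_lt_card this u
      have h1 := hget a ha.2.2 b hb.2.2 ha' hb' u hu w hw.symm hab
      have h2 := hget c hc e he hdc hde u hv w hw.symm hce
      grind
    · have h1 := hget a ha.2.2 b hb.2.2 ha' hb' u hu v huv hab
      have h2 := hget c hc e he hdc hde v hv u (Ne.symm huv) hce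
      rw [EdgeLabeling.get_comm] at h2
      grind
  · have hlow := hd a ha
    have hlt' : 2 * d a + 1 < Fintype.card V := lt_of_le_of_ne hlow.two_mul_lt hlt
    have hdis : Disjoint (lowVerts φ a (d a)) (lowVerts φ c (d c) ∪ lowVerts φ e (d e)) :=
      Finset.disjoint_union_right.2 ⟨disjoint_lowVerts φ hac (by omega),
        disjoint_lowVerts φ hae (by omega)⟩
    have h1 := hinter c hc e he hdc hde
    have h2 := (lowVerts φ a (d a) ∪ (lowVerts φ c (d c) ∪ lowVerts φ e (d e))).card_le_univ
    rw [Finset.card_union_of_disjoint hdis] at h2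
    have h3 := hlow.le_card
    have h4 := hlow.pos
    obtain ⟨u, hu⟩ : (lowVerts φ a (d a)).Nonempty := Finset.card_pos.1 (by omega)
    have h5 : (lowVerts φ c (d c) ∩ lowVerts φ e (d e)).card ≤ nb (offGraph φ a) u Finset.univ := by
      unfold nb
      refine Finset.card_le_card fun v hv => Finset.mem_filter.2 ⟨Finset.mem_univ _, ?_⟩
      have hne : v ≠ u := by
        rintro rfl
        exact Finset.disjoint_left.1 hdis hu (Finset.mem_union_left _ (Finset.mem_inter.1 hv).1)
      refine ⟨hne.symm, ?_⟩
      have := hget c hc e he hdc hde v hv u hne hce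
      rw [EdgeLabeling.get_comm] at this
      grind
    rw [mem_lowVerts] at hu
    omega

theorem two_mul_lt_of_isLow [DecidableEq V] {φ : TopEdgeLabeling V ℕ} {C : Finset ℕ} {d : ℕ → ℕ}
    (hC : 4 ≤ C.card) (hd : ∀ a ∈ C, IsLow φ a (d a)) {c e : ℕ} (hc : c ∈ C) (he : e ∈ C)
    (hce : c ≠ e) : d c + d e + 1 < Fintype.card V := by
  have h1 := (hd c hc).two_mul_lt
  have h2 := (hd e he).two_mul_lt
  by_contra! h
  exact hce (eq_of_isLow_of_isLow hC hd hc he (by omega) (by omega))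

theorem sum_nb_le (φ : TopEdgeLabeling V ℕ) {a D : ℕ} {M : Finset V} (hM : M ⊆ lowVerts φ a D) :
    ∑ v ∈ M, nb (offGraph φ a) v Finset.univ ≤ M.card * D :=
  Finset.sum_le_card_nsmul _ _ _ fun _ hv => mem_lowVerts.1 (hM hv)

theorem exists_subset_lowVerts {φ : TopEdgeLabeling V ℕ} {C : Finset ℕ} {d : ℕ → ℕ}
    (hd : ∀ a ∈ C, d a ≤ (lowVerts φ a (d a)).card) :
    ∃ M : ℕ → Finset V, ∀ a ∈ C, M a ⊆ lowVerts φ a (d a) ∧ (M a).card = d a := by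
  choose! M hM using fun a ha => Finset.exists_subset_card_eq (hd a ha)
  exact ⟨M, hM⟩

theorem finite_range_coloring (φ : TopEdgeLabeling V ℕ) : (Set.range φ).Finite :=
  haveI : Finite (⊤ : SimpleGraph V).edgeSet := inferInstance
  Set.finite_range (ι := (⊤ : SimpleGraph V).edgeSet) φ

/-- Disjoint classes of d vertices have off-degree sums at most d², which makes the double count (∑
d)² ≤ 3 ∑ d². The largest d is then at least 3 · 2^(k - 4), and 2d + 1 ≤ n. -/
theorem card_le_of_isPolychromatic_cycleFamily {φ : TopEdgeLabeling V ℕ}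
    (hn : 3 ≤ Fintype.card V) (hφ : IsPolychromatic (cycleFamily V 0) φ) (hk : 4 ≤ numColors φ) :
    3 * 2 ^ (numColors φ - 3) + 1 ≤ Fintype.card V := by
  classical
  have hfin : (Set.range φ).Finite := finite_range_coloring φ
  set C := hfin.toFinset with hCdef
  have hkC : numColors φ = C.card := Set.ncard_eq_toFinset_card _ hfin
  rw [hkC] at hk ⊢
  have hex : ∀ a ∈ C, ∃ D, IsLow φ a D := fun a ha => by
    obtain ⟨D, h1, h2, h3, h4⟩ := exists_low_degrees_of_not_hasHamiltonianCycle hn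
      (not_hasHamiltonianCycle_offGraph hn hφ (by simpa [hCdef] using ha))
    exact ⟨D, h1, h2, h3, h4⟩
  choose! d hd using hex
  obtain ⟨M, hM⟩ := exists_subset_lowVerts fun a ha => (hd a ha).le_card
  obtain ⟨a, ha, hle⟩ := exists_large_of_subset_sums (C := C) (d := d) (F := fun x => 3 * x ^ 2)
    (t := 3 * 2 ^ (C.card - 4)) (fun x hpos hmono hsum => by
      push_cast
      exact three_mul_two_pow_le hpos hmono (fun j hj => by
        rw [Finset.mul_sum]; exact hsum j hj) hk) (by omega) (fun a ha => (hd a ha).pos) (by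
      intro J hJ
      have := sq_sum_card_le φ J M (fun a ha b hb hab => Finset.disjoint_of_subset_left (hM a (hJ ha)).1
        (Finset.disjoint_of_subset_right (hM b (hJ hb)).1
          (disjoint_lowVerts φ hab (two_mul_lt_of_isLow hk hd (hJ ha) (hJ hb) hab))))
        (fun a => d a ^ 2) (fun a ha => by
          refine (sum_nb_le φ (hM a (hJ ha)).1).trans_eq ?_
          rw [(hM a (hJ ha)).2, sq])
      have h1 : ∑ a ∈ J, (M a).card = ∑ a ∈ J, d a :=
        Finset.sum_congr rfl fun a ha => (hM a (hJ ha)).2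
      have h2 : ∑ a ∈ J, (M a).card ^ 2 = ∑ a ∈ J, d a ^ 2 :=
        Finset.sum_congr rfl fun a ha => by rw [(hM a (hJ ha)).2]
      rw [h1, h2] at this
      rw [← Finset.mul_sum]
      have h' : (∑ a ∈ J, d a) ^ 2 ≤ 3 * ∑ a ∈ J, d a ^ 2 := by omega
      exact_mod_cast h')
  have := (hd a ha).two_mul_lt
  have h2 : 2 ^ (C.card - 3) = 2 * 2 ^ (C.card - 4) := by
    rw [← pow_succ', show C.card - 4 + 1 = C.card - 3 by omega]
  omega

/-- The classes of the colors in the `2`-factor case: `D + 1` vertices with few edges of other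
colors. -/
theorem exists_succ_subset_lowVerts [DecidableEq V] {φ : TopEdgeLabeling V ℕ} {a D : ℕ}
    (h1 : D ≤ (lowVerts φ a D).card) (h2 : D + 1 ≤ (lowVerts φ a (D + 1)).card) :
    ∃ M ⊆ lowVerts φ a (D + 1), M.card = D + 1 ∧
      ∑ v ∈ M, nb (offGraph φ a) v Finset.univ ≤ D ^ 2 + D + 1 := by
  obtain ⟨M, hM, hMc⟩ := Finset.exists_subset_card_eq h1
  have hsub : lowVerts φ a D ⊆ lowVerts φ a (D + 1) := fun v hv => by
    rw [mem_lowVerts] at hv ⊢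
    omega
  obtain ⟨v, hv, hvM⟩ := Finset.exists_mem_notMem_of_card_lt_card 
    (show M.card < (lowVerts φ a (D + 1)).card by omega)
  refine ⟨insert v M, Finset.insert_subset hv (hM.trans hsub), ?_, ?_⟩
  · rw [Finset.card_insert_of_notMem hvM, hMc]
  · rw [Finset.sum_insert hvM]
    have h3 := sum_nb_le φ hM
    rw [mem_lowVerts] at hv
    rw [hMc, ← sq] at h3
    omega

/-- The conditions on the degrees given by the criterion for `2`-factors. -/
structure IsFactorLow (φ : TopEdgeLabeling V ℕ) (a D : ℕ) : Prop where
  two_mul_lt : 2 * D + 1 ≤ Fintype.card V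
  le_card : D ≤ (lowVerts φ a D).card
  succ_le_card : D + 1 ≤ (lowVerts φ a (D + 1)).card
  lt_card : 2 * D + 1 = Fintype.card V → D + 1 ≤ (lowVerts φ a D).card

theorem IsFactorLow.isLow {φ : TopEdgeLabeling V ℕ} {a D : ℕ} (h : IsFactorLow φ a D)
    (hn : 4 ≤ Fintype.card V) : IsLow φ a (max D 1) := by
  obtain ⟨h1, h2, h3, h4⟩ := h
  obtain rfl | hD := Nat.eq_zero_or_pos D
  · exact ⟨le_rfl, by simp; omega, h3, fun h => by simp at h; omega⟩
  · rw [max_eq_left hD]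
    exact ⟨hD, h1, h2, h4⟩

theorem sum_card_le [DecidableEq V] {C : Finset ℕ} {M : ℕ → Finset V}
    (hM : ∀ a ∈ C, ∀ b ∈ C, a ≠ b → Disjoint (M a) (M b)) :
    ∑ a ∈ C, (M a).card ≤ Fintype.card V := by
  rw [← Finset.card_biUnion hM]
  exact Finset.card_le_univ _

/-- Classes of x = D + 1 vertices have off-degree sums at most D² + D + 1, and x² + 2(D² + D + 1) =
3x² - 2x + 2. They are disjoint as long as no two colors have D near n/2. -/
theorem two_pow_le_of_unique_big [DecidableEq V] {φ : TopEdgeLabeling V ℕ} {C : Finset ℕ}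
    {D : ℕ → ℕ} (hC : 4 ≤ C.card) (hD : ∀ a ∈ C, IsFactorLow φ a (D a))
    (hbig : ∀ a ∈ C, ∀ b ∈ C, Fintype.card V ≤ 2 * D a + 4 → Fintype.card V ≤ 2 * D b + 4 → a = b) :
    2 ^ (C.card - 1) ≤ Fintype.card V + 1 := by
  -- For 2D + 1 = n there are D + 1 vertices already at threshold D; threshold D + 1 would be too
  -- weak for disjointness.
  have hex : ∀ a ∈ C, ∃ M ⊆ lowVerts φ a (if 2 * D a + 1 = Fintype.card V then D a else D a + 1),
      M.card = D a + 1 ∧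
      ∑ v ∈ M, nb (offGraph φ a) v Finset.univ ≤ D a ^ 2 + D a + 1 := by
    intro a ha
    split_ifs with h
    · obtain ⟨M, hM, hMc⟩ := Finset.exists_subset_card_eq ((hD a ha).lt_card h)
      refine ⟨M, hM, hMc, (sum_nb_le φ hM).trans ?_⟩
      rw [hMc]
      nlinarith
    · exact exists_succ_subset_lowVerts (hD a ha).le_card (hD a ha).succ_le_card
  choose! M hM hMc hMs using hex
  have hdis : ∀ a ∈ C, ∀ b ∈ C, a ≠ b → Disjoint (M a) (M b) := by
    intro a ha b hb hab
    refine Finset.disjoint_of_subset_left (hM a ha) (Finset.disjoint_of_subset_right (hM b hb)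
      (disjoint_lowVerts φ hab ?_))
    have h1 := (hD a ha).two_mul_lt
    have h2 := (hD b hb).two_mul_lt
    have h3 := hbig a ha b hb
    split_ifs <;> by_contra! h <;> exact hab (h3 (by omega) (by omega))
  obtain ⟨a, ha, hle⟩ := exists_large_of_subset_sums (C := C) (d := fun a => D a + 1)
    (F := fun x => 3 * x ^ 2 - 2 * x + 2) (t := 4 * 2 ^ (C.card - 4)) (fun x hpos hmono hsum => by
      push_cast
      exact two_pow_le hpos hmono hsum hC) (by omega) (fun a ha => Nat.succ_pos _) (by
      intro J hJ
      have := sq_sum_card_le φ J M (fun a ha b hb => hdis a (hJ ha) b (hJ hb)) _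
        (fun a ha => hMs a (hJ ha))
      have h1 : ∑ a ∈ J, (M a).card = ∑ a ∈ J, (D a + 1) :=
        Finset.sum_congr rfl fun a ha => hMc a (hJ ha)
      have h2 : ∑ a ∈ J, (M a).card ^ 2 = ∑ a ∈ J, (D a + 1) ^ 2 :=
        Finset.sum_congr rfl fun a ha => by rw [hMc a (hJ ha)]
      rw [h1, h2, Finset.mul_sum, ← Finset.sum_add_distrib] at this
      zify at this
      refine this.trans_eq (Finset.sum_congr rfl fun a _ => ?_)
      push_cast
      ring)
  have := (hD a ha).two_mul_lt
  have h2 : 2 ^ (C.card - 1) = 8 * 2 ^ (C.card - 4) := by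
    rw [show C.card - 1 = 3 + (C.card - 4) by omega, pow_add]
    norm_num
  omega

/-- Two colors with D near n/2 occupy at least n - 4 vertices by classes of size D. The remaining
classes are nonempty and share at most four vertices, so at most four further colors exist. -/
theorem two_pow_le_of_big [DecidableEq V] {φ : TopEdgeLabeling V ℕ} {C : Finset ℕ}
    {D : ℕ → ℕ} (hC : 5 ≤ C.card) (hn : 13 ≤ Fintype.card V)
    (hD : ∀ a ∈ C, IsFactorLow φ a (D a)) {c e : ℕ} (hc : c ∈ C) (he : e ∈ C) (hce : c ≠ e)
    (hbc : Fintype.card V ≤ 2 * D c + 4) (hbe : Fintype.card V ≤ 2 * D e + 4) :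
    2 ^ (C.card - 1) ≤ Fintype.card V + 1 := by
  classical
  set n := Fintype.card V with hn_def
  have hex : ∀ a ∈ C, ∃ M : Finset V,
      (n ≤ 2 * D a + 4 → M ⊆ lowVerts φ a (D a) ∧ M.card = D a ∧
        ∑ v ∈ M, nb (offGraph φ a) v Finset.univ ≤ D a ^ 2) ∧
      (¬ n ≤ 2 * D a + 4 → M ⊆ lowVerts φ a (D a + 1) ∧ M.card = D a + 1 ∧
        ∑ v ∈ M, nb (offGraph φ a) v Finset.univ ≤ D a ^ 2 + D a + 1) := by
    intro a ha
    by_cases h : n ≤ 2 * D a + 4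
    · obtain ⟨M, hM, hMc⟩ := Finset.exists_subset_card_eq (hD a ha).le_card
      refine ⟨M, fun _ => ⟨hM, hMc, (sum_nb_le φ hM).trans_eq ?_⟩, fun h' => absurd h h'⟩
      rw [hMc, sq]
    · obtain ⟨M, hM⟩ := exists_succ_subset_lowVerts (hD a ha).le_card (hD a ha).succ_le_card
      exact ⟨M, fun h' => absurd h' h, fun _ => hM⟩
  choose! M hMb hMs using hex
  have hdis : ∀ a ∈ C, ∀ b ∈ C, a ≠ b → Disjoint (M a) (M b) := by
    intro a ha b hb hab
    have h1 := (hD a ha).two_mul_lt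
    have h2 := (hD b hb).two_mul_lt
    have h3 := two_mul_lt_of_isLow (by omega) (fun a ha => (hD a ha).isLow (by omega)) ha hb hab
    have key : ∀ r s, M a ⊆ lowVerts φ a r → M b ⊆ lowVerts φ b s → r + s + 1 < n →
        Disjoint (M a) (M b) := fun r s hr hs hrs =>
      Finset.disjoint_of_subset_left hr (Finset.disjoint_of_subset_right hs
        (disjoint_lowVerts φ hab hrs))
    by_cases ha' : n ≤ 2 * D a + 4 <;> by_cases hb' : n ≤ 2 * D b + 4
    · exact key _ _ (hMb a ha ha').1 (hMb b hb hb').1 (by omega)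
    · exact key _ _ (hMb a ha ha').1 (hMs b hb hb').1 (by omega)
    · exact key _ _ (hMs a ha ha').1 (hMb b hb hb').1 (by omega)
    · exact key _ _ (hMs a ha ha').1 (hMs b hb hb').1 (by omega)
  have hsum := sum_card_le hdis
  set R := (C.erase c).erase e with hR
  have heC : e ∈ C.erase c := Finset.mem_erase.2 ⟨hce.symm, he⟩
  have hsplit : ∀ f : ℕ → ℕ, ∑ a ∈ C, f a = f c + (f e + ∑ a ∈ R, f a) := fun f => by
    rw [hR, Finset.add_sum_erase _ _ heC, Finset.add_sum_erase _ _ hc]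
  have hRC : R ⊆ C := (Finset.erase_subset _ _).trans (Finset.erase_subset _ _)
  have hRcard : R.card + 2 = C.card := by
    rw [hR, Finset.card_erase_of_mem heC, Finset.card_erase_of_mem hc]
    omega
  have hMc := (hMb c hc hbc).2.1
  have hMe := (hMb e he hbe).2.1
  rw [hsplit, hMc, hMe] at hsum
  have hRsum : ∑ a ∈ R, (M a).card ≤ 4 := by omega
  -- As n ≥ 13, a third class of this size would have at least five vertices.
  have hsmall : ∀ a ∈ R, ¬ n ≤ 2 * D a + 4 := by
    intro a ha h
    have := (hMb a (hRC ha) h).2.1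
    have := Finset.single_le_sum (f := fun a => (M a).card) (fun _ _ => Nat.zero_le _) ha
    omega
  have hRM : ∀ a ∈ R, (M a).card = D a + 1 := fun a ha => (hMs a (hRC ha) (hsmall a ha)).2.1
  have hRB : ∀ a ∈ R, ∑ v ∈ M a, nb (offGraph φ a) v Finset.univ ≤ D a ^ 2 + D a + 1 :=
    fun a ha => (hMs a (hRC ha) (hsmall a ha)).2.2
  have hRsum' : ∑ a ∈ R, D a + R.card ≤ 4 := by
    rw [Finset.sum_congr rfl hRM, Finset.sum_add_distrib] at hRsum
    simpa using hRsum
  -- With five colors the bound could fail only for n = 13 or 14, and the double count excludes each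
  -- case. With six colors four classes are single vertices with D = 0, and the double count would
  -- read 16 ≤ 12.
  by_cases h3 : R.card = 3
  · by_contra! hlt
    rw [show C.card - 1 = 4 by omega] at hlt
    obtain ⟨x, y, z, hxy, hxz, hyz, hRe⟩ := Finset.card_eq_three.1 h3
    have hR3 : ∀ f : ℕ → ℕ, ∑ a ∈ R, f a = f x + f y + f z := fun f => by
      rw [hRe, Finset.sum_insert (by simp [hxy, hxz]), Finset.sum_insert (by simp [hyz]),
        Finset.sum_singleton, add_assoc]
    have hx : x ∈ R := by simp [hRe]
    have hy : y ∈ R := by simp [hRe]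
    have hz : z ∈ R := by simp [hRe]
    have hsq := sq_sum_card_le φ C M hdis _ (fun a _ => le_rfl)
    rw [hsplit, hsplit, hsplit, hR3, hR3, hR3, hMc, hMe, hRM x hx, hRM y hy, hRM z hz] at hsq
    rw [hR3, h3] at hRsum'
    rw [hR3, hRM x hx, hRM y hy, hRM z hz] at hsum
    have h1 := (hMb c hc hbc).2.2
    have h2 := (hMb e he hbe).2.2
    have h4 := hRB x hx
    have h5 := hRB y hy
    have h6 := hRB z hz
    have h7 := (hD c hc).two_mul_lt
    have h8 := (hD e he).two_mul_lt
    generalize D c = p at *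
    generalize D e = q at *
    generalize D x = u at *
    generalize D y = v at *
    generalize D z = w at *
    have hp : p = 5 ∨ p = 6 := by omega
    have hq : q = 5 ∨ q = 6 := by omega
    have huvw : (u = 0 ∧ v = 0 ∧ w = 0) ∨ (u = 1 ∧ v = 0 ∧ w = 0) ∨ (u = 0 ∧ v = 1 ∧ w = 0) ∨
      (u = 0 ∧ v = 0 ∧ w = 1) := by omega
    rcases hp with rfl | rfl <;> rcases hq with rfl | rfl <;>
      rcases huvw with ⟨rfl, rfl, rfl⟩ | ⟨rfl, rfl, rfl⟩ | ⟨rfl, rfl, rfl⟩ | ⟨rfl, rfl, rfl⟩ <;>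
      omega
  · exfalso
    have h4 : R.card = 4 := by omega
    have hD0 : ∀ a ∈ R, D a = 0 := Finset.sum_eq_zero_iff.1 (by omega)
    have hsq := sq_sum_card_le φ R M (fun a ha b hb => hdis a (hRC ha) b (hRC hb)) _ hRB
    rw [Finset.sum_congr rfl fun a ha => show (M a).card = 1 by rw [hRM a ha, hD0 a ha],
      Finset.sum_congr rfl fun a ha => show (M a).card ^ 2 = 1 by rw [hRM a ha, hD0 a ha]; rfl,
      Finset.sum_congr rfl fun a ha => show D a ^ 2 + D a + 1 = 1 by rw [hD0 a ha]; rfl] at hsq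
    simp [h4] at hsq

/-- Hamiltonian cycles are 2-factors, so the cycle bound applies as well. It settles four colors,
and from five colors on it guarantees the n ≥ 13 needed when two colors have D near n/2. -/
theorem two_pow_le_of_isPolychromatic_twoRegularFamily {φ : TopEdgeLabeling V ℕ}
    (hn : 3 ≤ Fintype.card V) (hφ : IsPolychromatic (twoRegularFamily V 0) φ) :
    2 ^ (numColors φ - 1) ≤ Fintype.card V + 1 := by
  classical
  obtain hk | hk : numColors φ ≤ 3 ∨ 4 ≤ numColors φ := by omega
  · have : 2 ^ (numColors φ - 1) ≤ 2 ^ 2 := Nat.pow_le_pow_right (by norm_num) (by omega)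
    omega
  have hcyc := card_le_of_isPolychromatic_cycleFamily hn (fun H hH => hφ H (cycleFamily_subset hH)) hk
  obtain hk | hk : numColors φ = 4 ∨ 5 ≤ numColors φ := by omega
  · rw [hk] at hcyc ⊢
    omega
  have hn13 : 13 ≤ Fintype.card V := by
    have : 2 ^ 2 ≤ 2 ^ (numColors φ - 3) := Nat.pow_le_pow_right (by norm_num) (by omega)
    omega
  have hfin := finite_range_coloring φ
  set C := hfin.toFinset with hCdef
  have hkC : numColors φ = C.card := Set.ncard_eq_toFinset_card _ hfin
  rw [hkC] at hk ⊢
  have hex : ∀ a ∈ C, ∃ D, IsFactorLow φ a D := fun a ha => by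
    obtain ⟨D, h1, h2, h3, h4⟩ := exists_low_degrees_of_not_hasTwoFactor hn
      (not_hasTwoFactor_offGraph hφ (by simpa [hCdef] using ha))
    exact ⟨D, h1, h2, h3, h4⟩
  choose! D hD using hex
  by_cases hbig : ∀ a ∈ C, ∀ b ∈ C, Fintype.card V ≤ 2 * D a + 4 → Fintype.card V ≤ 2 * D b + 4 →
      a = b
  · exact two_pow_le_of_unique_big (by omega) hD hbig
  · push Not at hbig
    obtain ⟨c, hc, e, he, hbc, hbe, hce⟩ := hbig
    exact two_pow_le_of_big hk hn13 hD hc he hce hbc hbe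

end

/-! ### The extremal colorings and their order structure -/

/-- The edge coloring of the complete graph on `Fin n` that gives the edge `ij`, `i < j`, the color
`f i j`. -/
def pairColoring (n : ℕ) (f : ℕ → ℕ → ℕ) : TopEdgeLabeling (Fin n) ℕ :=
  fun e => f (Sym2.inf e.1 : Fin n) (Sym2.sup e.1 : Fin n)

theorem pairColoring_get {n : ℕ} (f : ℕ → ℕ → ℕ) (u v : Fin n)
    (h : (⊤ : SimpleGraph (Fin n)).Adj u v) :
    (pairColoring n f).get u v h = f (min u.1 v.1) (max u.1 v.1) := by
  change f ((u ⊓ v : Fin n) : ℕ) ((u ⊔ v : Fin n) : ℕ) = _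
  rcases le_total u v with huv | huv
  · rw [inf_eq_left.2 huv, sup_eq_right.2 huv, min_eq_left (Fin.le_def.1 huv),
      max_eq_right (Fin.le_def.1 huv)]
  · rw [inf_eq_right.2 huv, sup_eq_left.2 huv, min_eq_right (Fin.le_def.1 huv),
      max_eq_left (Fin.le_def.1 huv)]

theorem isSimplyOrdered_of_monotone {V : Type*} {χ : TopEdgeLabeling V ℕ} {N : ℕ} (v : Fin N ≃ V)
    {g : Fin N → ℕ} (hg : Monotone g)
    (h : ∀ (i j : Fin N) (hij : i < j), χ.get (v i) (v j) (adj_of_lt v hij) = g i) :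
    IsSimplyOrdered χ := by
  refine ⟨N, v, fun i j m hij hjm => by rw [h _ _ hij, h _ _ (hij.trans hjm)],
    fun i j m hij hjm heq t hit htj => ?_⟩
  rw [h _ _ hjm, h _ _ (hij.trans hjm)] at heq
  rw [h _ _ (htj.trans_lt hjm), h _ _ (hij.trans hjm)]
  exact le_antisymm (heq ▸ hg htj) (hg hit)

theorem colorDegree_add_two {V : Type*} [Finite V] {χ : TopEdgeLabeling V ℕ} {v x : V} {c : ℕ}
    (hx : x ≠ v) (h : ∀ u (hu : (⊤ : SimpleGraph V).Adj v u), χ.get v u hu = c ↔ u ≠ x) :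
    colorDegree χ v c + 2 = Nat.card V := by
  unfold colorDegree
  have : {u : V | ∃ h : (⊤ : SimpleGraph V).Adj v u, χ.get v u h = c} = {v, x}ᶜ := by
    ext u
    simp only [Set.mem_ofPred_eq, Set.mem_compl_iff, Set.mem_insert_iff, Set.mem_singleton_iff, not_or]
    constructor
    · rintro ⟨hu, hc⟩
      exact ⟨hu.ne.symm, (h u hu).1 hc⟩
    · rintro ⟨h1, h2⟩
      exact ⟨Ne.symm h1, (h u (Ne.symm h1)).2 h2⟩
  rw [this, ← Set.ncard_pair hx.symm, add_comm, Set.ncard_add_ncard_compl]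

/-- The number of the last of `k` intervals, starting at `σ 0, …, σ (k - 1)`, that starts at or
before `i`. -/
def level (σ : ℕ → ℕ) (k i : ℕ) : ℕ :=
  Nat.findGreatest (fun c => σ c ≤ i) (k - 1)

theorem level_mono (σ : ℕ → ℕ) (k : ℕ) : Monotone (level σ k) := fun _ _ hij =>
  Nat.findGreatest_mono_left (fun _ hc => le_trans hc hij) _

/-- The simply-ordered coloring whose color classes start at the vertices `σ c`. -/
def levelColoring (n : ℕ) (σ : ℕ → ℕ) (k : ℕ) : TopEdgeLabeling (Fin n) ℕ :=
  pairColoring n fun i _ => level σ k i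

/-- The coloring `levelColoring`, with the edge between the vertices `0` and `2` recolored. -/
def recoloring (n : ℕ) (σ : ℕ → ℕ) (k : ℕ) : TopEdgeLabeling (Fin n) ℕ :=
  pairColoring n fun i j => if i = 0 ∧ j = 2 then 2 else level σ k i

/-- Conditions on the interval lengths under which `recoloring` is polychromatic for the
Hamiltonian cycles. -/
structure IsAdmissible (n : ℕ) (σ : ℕ → ℕ) (k : ℕ) : Prop where
  three_le : 3 ≤ n
  three_le_colors : 3 ≤ k
  strictMono : StrictMono σ
  eq_self : ∀ c ≤ 3, σ c = c
  two_mul_le : ∀ c, 3 ≤ c → 2 * σ c ≤ σ (c + 1)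
  lt_card : 4 ≤ k → 2 * σ (k - 1) + 1 ≤ n

namespace IsAdmissible

variable {n k : ℕ} {σ : ℕ → ℕ}

theorem level_eq (h : IsAdmissible n σ k) {c i : ℕ} (hc : c < k) (hi : σ c ≤ i) (hi' : c + 1 < k → i < σ (c + 1)) :
    level σ k i = c := by
  rw [level, Nat.findGreatest_eq_iff]
  refine ⟨by omega, fun _ => hi, fun m hcm hm hle => ?_⟩
  have := h.strictMono.monotone (show c + 1 ≤ m from hcm)
  have := hi' (by omega)
  omega

theorem level_lt (h : IsAdmissible n σ k) (i : ℕ) : level σ k i < k := by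
  have := Nat.findGreatest_le (P := fun c => σ c ≤ i) (k - 1)
  have := h.three_le_colors
  unfold level
  omega

theorem level_small (h : IsAdmissible n σ k) {i : ℕ} (hi : i ≤ 2) : level σ k i = i := by
  have := h.three_le_colors
  refine h.level_eq (by omega) (h.eq_self i (by omega)).le fun _ => ?_
  rw [h.eq_self _ (by omega)]
  omega

theorem le_of_level_eq (h : IsAdmissible n σ k) {c i : ℕ} (hi : level σ k i = c) : σ c ≤ i := by
  have := Nat.findGreatest_spec (P := fun c => σ c ≤ i) (Nat.zero_le (k - 1))
    (by rw [h.eq_self 0 (by omega)]; omega)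
  subst hi
  exact this

theorem start_lt (h : IsAdmissible n σ k) {c : ℕ} (hc : c < k) (hc3 : 3 ≤ c) : 2 * σ c + 1 ≤ n := by
  have := h.strictMono.monotone (show c ≤ k - 1 by omega)
  have := h.lt_card (by omega)
  omega

theorem recoloring_get_of_three_le {u v : Fin n} (hv : 3 ≤ v.1)
    (h' : (⊤ : SimpleGraph (Fin n)).Adj u v) :
    (recoloring n σ k).get u v h' = level σ k (min u.1 v.1) := by
  rw [recoloring, pairColoring_get, if_neg]
  rintro ⟨-, h2⟩
  have := le_max_right u.1 v.1
  omega

/-- The edge at one of the vertices `0`, `1`, `2` whose color in `recoloring` differs from that of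
the other edges at this vertex. -/
theorem recoloring_get_small (h : IsAdmissible n σ k) {v u x : Fin n} (hv : v.1 ≤ 2)
    (hx : x.1 = (v.1 + 2) % 3) (huv : (⊤ : SimpleGraph (Fin n)).Adj v u) :
    (recoloring n σ k).get v u huv = if u = x then x.1 else v.1 := by
  have hne : v.1 ≠ u.1 := fun h => huv.ne (Fin.ext h)
  have h0 := h.level_small (i := 0) (by omega)
  have h1 := h.level_small (i := 1) (by omega)
  have h2 := h.level_small (i := 2) (by omega)
  rw [recoloring, pairColoring_get]
  simp only [Fin.ext_iff, hx]
  obtain hlt | hlt := lt_or_gt_of_ne hne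
  · rw [min_eq_left hlt.le, max_eq_right hlt.le]
    obtain hv | hv | hv : v.1 = 0 ∨ v.1 = 1 ∨ v.1 = 2 := by omega
    · by_cases hu : u.1 = 2 <;> simp [hv, h0, hu]
    · simp [hv, h1]
      omega
    · simp [hv, h2]
      omega
  · rw [min_eq_right hlt.le, max_eq_left hlt.le]
    obtain hv | hv : v.1 = 1 ∨ v.1 = 2 := by omega
    · have hu : u.1 = 0 := by omega
      simp [hv, hu, h0]
    · obtain hu | hu : u.1 = 0 ∨ u.1 = 1 := by omega
      · simp [hv, hu]
      · simp [hv, hu, h1]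

theorem isSimplyOrdered_levelColoring : IsSimplyOrdered (levelColoring n σ k) := by
  refine isSimplyOrdered_of_monotone (Equiv.refl (Fin n)) (g := fun i => level σ k i)
    (fun i j hij => level_mono σ k hij) fun i j hij => ?_
  rw [levelColoring, pairColoring_get]
  exact congrArg _ (min_eq_left (Fin.le_def.1 hij.le))

theorem isOneEdgeRecoloring (h : IsAdmissible n σ k) :
    IsOneEdgeRecoloring (levelColoring n σ k) (recoloring n σ k) := by
  have hn := h.three_le
  have h02 : (⊤ : SimpleGraph (Fin n)).Adj ⟨0, by omega⟩ ⟨2, by omega⟩ := by simp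
  refine ⟨⟨s(⟨0, by omega⟩, ⟨2, by omega⟩), h02⟩, ?_, ?_⟩
  · change (recoloring n σ k).get _ _ h02 ≠ (levelColoring n σ k).get _ _ h02
    rw [recoloring, levelColoring, pairColoring_get, pairColoring_get]
    simp [h.level_small (i := 0) (by omega)]
  · rintro ⟨e, he⟩ hne
    induction e using Sym2.ind with
    | _ u v =>
      have huv : (⊤ : SimpleGraph (Fin n)).Adj u v := he
      have hne' : (recoloring n σ k).get u v huv ≠ (levelColoring n σ k).get u v huv := hne
      rw [recoloring, levelColoring, pairColoring_get, pairColoring_get] at hne'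
      have : min u.1 v.1 = 0 ∧ max u.1 v.1 = 2 := by
        by_contra hcon
        exact hne' (if_neg hcon)
      apply Subtype.ext
      change s(u, v) = s(_, _)
      rw [Sym2.eq_iff]
      simp only [Fin.ext_iff]
      omega

/-- With Z = {0, 1, 2} the recolored triangle is cyclic: the edge from v to its predecessor mod 3
has the color of the predecessor, all other edges at v have color v. -/
theorem isQuasiSimplyOrdered (h : IsAdmissible n σ k) :
    ∃ Z : Finset (Fin n), Z.card = 3 ∧ IsQuasiSimplyOrdered (recoloring n σ k) Z := by
  have hn := h.three_le
  have hmem : ∀ v : Fin n, v ∈ (Finset.range 3).attachFin (n := n)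
      (fun m hm => by rw [Finset.mem_range] at hm; omega) ↔ v.1 ≤ 2 := fun v => by
    rw [Finset.mem_attachFin, Finset.mem_range]
    omega
  have hcard : ((Finset.range 3).attachFin (n := n)
      (fun m hm => by rw [Finset.mem_range] at hm; omega)).card = 3 := by
    rw [Finset.card_attachFin, Finset.card_range]
  generalize (Finset.range 3).attachFin (n := n) _ = Z at hmem hcard
  have hdeg : ∀ v x : Fin n, v.1 ≤ 2 → x.1 = (v.1 + 2) % 3 →
      colorDegree (recoloring n σ k) v v.1 + 2 = Nat.card (Fin n) := by
    intro v x hv hx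
    refine colorDegree_add_two (x := x) (fun hxv => by rw [hxv] at hx; omega) fun u hu => ?_
    rw [recoloring_get_small h hv hx]
    split_ifs with hux
    · exact ⟨fun hxv => by omega, fun hne => absurd hux hne⟩
    · exact ⟨fun _ => hux, fun _ => rfl⟩
  refine ⟨Z, hcard, ⟨Finset.card_pos.1 (by omega), ?_, ?_⟩, ?_⟩
  · intro v hv u hu w hw huv hwv
    rw [hmem] at hv hu hw
    rw [recoloring_get_small h hv (x := ⟨(v.1 + 2) % 3, by omega⟩) rfl,
      recoloring_get_small h hv (x := ⟨(v.1 + 2) % 3, by omega⟩) rfl, if_neg, if_neg]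
    · rw [Fin.ext_iff]; dsimp only; omega
    · rw [Fin.ext_iff]; dsimp only; omega
  · intro v hv
    rw [hmem] at hv
    have hx : (v.1 + 2) % 3 < n := by omega
    have hadj : (⊤ : SimpleGraph (Fin n)).Adj v ⟨(v.1 + 2) % 3, hx⟩ := by
      rw [top_adj, ne_eq, Fin.ext_iff]
      dsimp only
      omega
    refine ⟨v.1, hdeg v ⟨_, hx⟩ hv rfl, ⟨(v.1 + 2) % 3, hx⟩, (hmem _).2 (by dsimp only; omega),
      hadj, ?_⟩
    rw [recoloring_get_small h hv (x := ⟨_, hx⟩) rfl, if_pos rfl]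
    refine ⟨by dsimp only; omega, ?_⟩
    exact hdeg ⟨_, hx⟩ ⟨((v.1 + 2) % 3 + 2) % 3, by omega⟩ (by dsimp only; omega) rfl
  · have hZ : ∀ i : Fin (n - 3), (⟨i.1 + 3, by omega⟩ : Fin n) ∉ Z := fun i => by
      rw [hmem]
      dsimp only
      omega
    have hge : ∀ x : {x : Fin n // x ∉ Z}, 3 ≤ x.1.1 := fun x => by
      have := mt (hmem x.1).2 x.2
      omega
    let e : Fin (n - 3) ≃ {x : Fin n // x ∉ Z} :=
      { toFun := fun i => ⟨⟨i.1 + 3, by omega⟩, hZ i⟩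
        invFun := fun x => ⟨x.1.1 - 3, by have := hge x; omega⟩
        left_inv := fun i => Fin.ext (by simp)
        right_inv := fun x => Subtype.ext (Fin.ext (by have := hge x; dsimp only; omega)) }
    refine isSimplyOrdered_of_monotone e (g := fun i => level σ k (i.1 + 3))
      (fun i j hij => level_mono σ k (by simpa using hij)) fun i j hij => ?_
    change (recoloring n σ k).get (⟨i.1 + 3, by omega⟩ : Fin n) (⟨j.1 + 3, by omega⟩ : Fin n)
      (by rw [top_adj, ne_eq, Fin.ext_iff]; dsimp only; omega) = _
    rw [recoloring_get_of_three_le (by dsimp only; omega)]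
    congr 1
    exact min_eq_left (by dsimp only; omega)

theorem exists_get_eq (h : IsAdmissible n σ k) {c : ℕ} (hc : c < k) :
    ∃ (u v : Fin n) (huv : (⊤ : SimpleGraph (Fin n)).Adj u v), (recoloring n σ k).get u v huv = c := by
  have hn := h.three_le
  obtain hc2 | hc3 : c ≤ 2 ∨ 3 ≤ c := by omega
  · have hadj : (⊤ : SimpleGraph (Fin n)).Adj ⟨c, by omega⟩ ⟨(c + 1) % 3, by omega⟩ := by
      rw [top_adj, ne_eq, Fin.ext_iff]
      dsimp only
      omega
    refine ⟨_, _, hadj, ?_⟩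
    rw [recoloring_get_small h (x := ⟨(c + 2) % 3, by omega⟩) (by dsimp only; omega) rfl, if_neg]
    rw [Fin.ext_iff]
    dsimp only
    omega
  · have h1 := h.start_lt hc hc3
    have h3 := h.strictMono.monotone hc3
    rw [h.eq_self 3 le_rfl] at h3
    have hadj : (⊤ : SimpleGraph (Fin n)).Adj ⟨σ c, by omega⟩ ⟨σ c + 1, by omega⟩ := by
      simp
    refine ⟨_, _, hadj, ?_⟩
    rw [recoloring_get_of_three_le (by dsimp only; omega)]
    dsimp only
    rw [min_eq_left (by omega)]
    refine h.level_eq hc le_rfl fun _ => h.strictMono (Nat.lt_succ_self c)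

theorem range_recoloring (h : IsAdmissible n σ k) : Set.range (recoloring n σ k) = Set.Iio k := by
  ext c
  constructor
  · rintro ⟨⟨e, he⟩, rfl⟩
    induction e using Sym2.ind with
    | _ u v =>
      have huv : (⊤ : SimpleGraph (Fin n)).Adj u v := he
      change (recoloring n σ k).get u v huv < k
      rw [recoloring, pairColoring_get]
      have := h.three_le_colors
      split_ifs
      · omega
      · exact h.level_lt _
  · intro hc
    obtain ⟨u, v, huv, hc⟩ := h.exists_get_eq hc
    exact ⟨⟨s(u, v), huv⟩, hc⟩

theorem numColors_recoloring (h : IsAdmissible n σ k) : numColors (recoloring n σ k) = k := by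
  rw [numColors, h.range_recoloring, ← Finset.coe_Iio, Set.ncard_coe_finset, Nat.card_Iio]

end IsAdmissible

/-! ### The extremal colorings are polychromatic -/

namespace IsAdmissible

variable {n k : ℕ} {σ : ℕ → ℕ}

/-- Just one edge at the vertex c misses the color c, and H has two edges there. -/
theorem exists_adj_small (h : IsAdmissible n σ k) {H : (⊤ : SimpleGraph (Fin n)).Subgraph}
    (hdeg : ∀ v, (H.neighborSet v).ncard = 2) {c : ℕ} (hc : c ≤ 2) :
    ∃ (u v : Fin n) (huv : H.Adj u v), (recoloring n σ k).get u v huv.adj_sub = c := by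
  have hn := h.three_le
  obtain ⟨w, hw, hne⟩ := Set.exists_ne_of_one_lt_ncard
    (show 1 < (H.neighborSet ⟨c, by omega⟩).ncard by rw [hdeg]; omega) ⟨(c + 2) % 3, by omega⟩
  refine ⟨_, w, hw, ?_⟩
  rw [recoloring_get_small h (x := ⟨(c + 2) % 3, by omega⟩) hc rfl, if_neg hne]

/-- If w came at or after σ c, the earlier end of the edge vw would lie between σ c and v, hence at
level c, and the edge would have color c. -/
theorem lt_of_adj_of_level_eq (h : IsAdmissible n σ k) {H : (⊤ : SimpleGraph (Fin n)).Subgraph}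
    {c : ℕ} (hc3 : 3 ≤ c) (hc : c < k)
    (hno : ∀ (u v : Fin n) (huv : H.Adj u v), (recoloring n σ k).get u v huv.adj_sub ≠ c)
    {v w : Fin n} (hv : level σ k v = c) (hvw : H.Adj v w) : w.1 < σ c := by
  have h3 := h.strictMono.monotone hc3
  rw [h.eq_self 3 le_rfl] at h3
  have hσv := h.le_of_level_eq hv
  by_contra! hw
  refine hno w v hvw.symm ?_
  rw [recoloring_get_of_three_le (by omega)]
  refine le_antisymm ?_ ?_
  · rw [← hv]
    exact level_mono σ k (min_le_right _ _)
  · rw [← h.level_eq hc le_rfl fun _ => h.strictMono (Nat.lt_succ_self c)]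
    exact level_mono σ k (le_min hw hσv)

/-- Without color c, both edges at a vertex of interval c end among the σ c earlier vertices, each
of which absorbs at most two. Under equality all edges at the earlier vertices go back to the
interval. -/
theorem card_level_le (h : IsAdmissible n σ k) {H : (⊤ : SimpleGraph (Fin n)).Subgraph}
    (hdeg : ∀ v, (H.neighborSet v).ncard = 2) {c : ℕ} (hc3 : 3 ≤ c) (hc : c < k)
    (hno : ∀ (u v : Fin n) (huv : H.Adj u v), (recoloring n σ k).get u v huv.adj_sub ≠ c) :
    (Finset.univ.filter fun v : Fin n => level σ k v = c).card ≤ σ c ∧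
      ((Finset.univ.filter fun v : Fin n => level σ k v = c).card = σ c →
        ∀ w x : Fin n, w.1 < σ c → H.Adj w x → level σ k x = c) := by
  classical
  set M := Finset.univ.filter fun v : Fin n => level σ k v = c with hM
  set L := (Finset.range (σ c)).attachFin (n := n) (fun m hm => by
    have := h.start_lt hc hc3
    rw [Finset.mem_range] at hm
    omega) with hL
  have hLcard : L.card = σ c := by rw [hL, Finset.card_attachFin, Finset.card_range]
  have hML : ∀ v ∈ M, ∀ w, H.Adj v w → w ∈ L := fun v hv w hvw => by
    rw [hL, Finset.mem_attachFin, Finset.mem_range]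
    exact h.lt_of_adj_of_level_eq hc3 hc hno (Finset.mem_filter.1 hv).2 hvw
  have hnb : ∀ v, nb H.spanningCoe v Finset.univ = 2 := by
    intro v
    rw [← hdeg v, nb, ← Set.ncard_coe_finset]
    congr 1
    ext w
    simp
  have h1 : ∀ v ∈ M, 2 ≤ nb H.spanningCoe v L := by
    intro v hv
    rw [← hnb v]
    refine Finset.card_le_card fun w hw => ?_
    have hw := (Finset.mem_filter.1 hw).2
    exact Finset.mem_filter.2 ⟨hML v hv w hw, hw⟩
  have h2 : ∀ w ∈ L, nb H.spanningCoe w M ≤ 2 := fun w _ => by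
    rw [← hnb w]
    exact nb_mono _ _ (Finset.subset_univ _)
  have h4 : M.card * 2 ≤ ∑ w ∈ L, nb H.spanningCoe w M := by
    rw [← sum_nb_comm]
    exact Finset.card_nsmul_le_sum _ _ _ h1
  have h5 : ∑ w ∈ L, nb H.spanningCoe w M ≤ ∑ w ∈ L, 2 := Finset.sum_le_sum h2
  rw [Finset.sum_const, smul_eq_mul, hLcard] at h5
  refine ⟨by omega, fun hcard w x hw hwx => ?_⟩
  have h6 : ∑ w ∈ L, nb H.spanningCoe w M = ∑ w ∈ L, 2 := by
    rw [Finset.sum_const, smul_eq_mul, hLcard]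
    omega
  have hwL : w ∈ L := by rwa [hL, Finset.mem_attachFin, Finset.mem_range]
  have h7 := (Finset.sum_eq_sum_iff_of_le h2).1 h6 w hwL
  have h8 : (M.filter fun x => H.spanningCoe.Adj w x) =
      Finset.univ.filter fun x => H.spanningCoe.Adj w x := by
    refine Finset.eq_of_subset_of_card_le (Finset.filter_subset_filter _ (Finset.subset_univ _)) ?_
    have := hnb w
    unfold nb at this h7
    convert (this.trans h7.symm).le
  have hx : x ∈ Finset.univ.filter fun x => H.spanningCoe.Adj w x :=
    Finset.mem_filter.2 ⟨Finset.mem_univ _, hwx⟩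
  rw [← h8] at hx
  exact (Finset.mem_filter.1 (Finset.mem_filter.1 hx).1).2

theorem le_card_level (h : IsAdmissible n σ k) {c t : ℕ} (hc : c < k) (htn : t ≤ n)
    (ht : c + 1 < k → t ≤ σ (c + 1)) :
    t - σ c ≤ (Finset.univ.filter fun v : Fin n => level σ k v = c).card := by
  rw [← Nat.card_Ico, ← Finset.card_attachFin (n := n) (Finset.Ico (σ c) t) fun m hm => by
    rw [Finset.mem_Ico] at hm
    omega]
  refine Finset.card_le_card fun v hv => ?_
  rw [Finset.mem_attachFin, Finset.mem_Ico] at hv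
  exact Finset.mem_filter.2 ⟨Finset.mem_univ _, h.level_eq hc hv.1 fun hc' => hv.2.trans_le (ht hc')⟩

theorem two_mul_le_card_level (h : IsAdmissible n σ k) {c : ℕ} (hc3 : 3 ≤ c) (hc : c < k) :
    σ c ≤ (Finset.univ.filter fun v : Fin n => level σ k v = c).card := by
  have h1 := h.le_card_level (t := 2 * σ c) hc (by have := h.start_lt hc hc3; omega)
    fun _ => h.two_mul_le c hc3
  omega

theorem isPolychromatic_of (h : IsAdmissible n σ k) {𝓗 : Set (⊤ : SimpleGraph (Fin n)).Subgraph}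
    (hdeg : ∀ H ∈ 𝓗, ∀ v, (H.neighborSet v).ncard = 2)
    (h𝓗 : ∀ H ∈ 𝓗, ∀ c, 3 ≤ c → c < k →
      ∃ (u v : Fin n) (huv : H.Adj u v), (recoloring n σ k).get u v huv.adj_sub = c) :
    IsPolychromatic 𝓗 (recoloring n σ k) := by
  intro H hH c hc
  rw [h.range_recoloring, Set.mem_Iio] at hc
  obtain ⟨u, v, huv, hcol⟩ : ∃ (u v : Fin n) (huv : H.Adj u v),
      (recoloring n σ k).get u v huv.adj_sub = c := by
    obtain hc2 | hc3 : c ≤ 2 ∨ 3 ≤ c := by omega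
    · exact h.exists_adj_small (hdeg H hH) hc2
    · exact h𝓗 H hH c hc3 hc
  exact ⟨⟨s(u, v), huv.adj_sub⟩, huv, hcol⟩

/-- Every interval from the fourth on has more vertices than precede it, one too many for a 2-factor
that misses its color. -/
theorem isPolychromatic_twoRegularFamily (h : IsAdmissible n σ k)
    (hσ : ∀ c, 3 ≤ c → 2 * σ c + 1 ≤ σ (c + 1)) :
    IsPolychromatic (twoRegularFamily (Fin n) 0) (recoloring n σ k) := by
  have hdeg : ∀ H ∈ twoRegularFamily (Fin n) 0, ∀ v, (H.neighborSet v).ncard = 2 := by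
    rintro H ⟨h1, h2⟩ v
    refine h1 v ?_
    have : H.verts = Set.univ := Set.eq_of_subset_of_ncard_le (Set.subset_univ _) (by
      rw [Set.ncard_univ]
      exact h2)
    rw [this]
    trivial
  refine h.isPolychromatic_of hdeg fun H hH c hc3 hc => ?_
  by_contra! hno
  have h1 := (h.card_level_le (hdeg H hH) hc3 hc hno).1
  have h2 := h.le_card_level (t := 2 * σ c + 1) hc (h.start_lt hc hc3) fun _ => hσ c hc3
  omega

/-- An interval may be exactly as long as what precedes it. A cycle missing its color would then be
confined to these 2σ c vertices by connectedness, but n > 2σ c. -/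
theorem isPolychromatic_cycleFamily (h : IsAdmissible n σ k) :
    IsPolychromatic (cycleFamily (Fin n) 0) (recoloring n σ k) := by
  refine h.isPolychromatic_of (fun H hH => (cycleFamily_spec hH).2.2) fun H hH c hc3 hc => ?_
  obtain ⟨hconn, hverts, hdeg⟩ := cycleFamily_spec hH
  by_contra! hno
  obtain ⟨h1, h2⟩ := h.card_level_le hdeg hc3 hc hno
  have hcard : (Finset.univ.filter fun v : Fin n => level σ k v = c).card = σ c :=
    le_antisymm h1 (h.two_mul_le_card_level hc3 hc)
  have hlt := h.start_lt hc hc3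
  have hclosed : ∀ v w : Fin n, H.Adj v w → v.1 < σ c ∨ level σ k v = c →
      w.1 < σ c ∨ level σ k w = c := by
    rintro v w hvw (hv | hv)
    · exact Or.inr (h2 hcard v w hv hvw)
    · exact Or.inl (h.lt_of_adj_of_level_eq hc3 hc hno hv hvw)
  have hall : ∀ v : Fin n, v.1 < σ c ∨ level σ k v = c := by
    by_contra! hcon
    obtain ⟨v, hv⟩ := hcon
    have h0 : (⟨0, by omega⟩ : Fin n).1 < σ c := by
      have := h.strictMono.monotone hc3
      rw [h.eq_self 3 le_rfl] at this
      dsimp only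
      omega
    obtain ⟨p⟩ := hconn.coe.preconnected ⟨⟨0, by omega⟩, hverts _⟩ ⟨v, hverts v⟩
    obtain ⟨d, -, hd1, hd2⟩ := p.exists_boundary_dart
      {x | x.1.1 < σ c ∨ level σ k x.1 = c} (Or.inl h0) fun h => h.elim (not_lt.2 hv.1) hv.2
    exact hd2 (hclosed _ _ d.adj hd1)
  have hcover : n ≤ ((Finset.range (σ c)).attachFin (n := n) (fun m hm => by
      rw [Finset.mem_range] at hm
      omega) ∪ Finset.univ.filter fun v : Fin n => level σ k v = c).card := by
    conv_lhs => rw [← Fintype.card_fin n, ← Finset.card_univ]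
    refine Finset.card_le_card fun v _ => ?_
    rw [Finset.mem_union, Finset.mem_attachFin, Finset.mem_range, Finset.mem_filter]
    exact (hall v).imp id fun h => ⟨Finset.mem_univ _, h⟩
  have := hcover.trans (Finset.card_union_le _ _)
  rw [hcard, Finset.card_attachFin, Finset.card_range] at this
  omega

end IsAdmissible

/-! ### Interval lengths and the polychromatic numbers -/

theorem isAdmissible_twoRegularFamily {n k : ℕ} (hn : 3 ≤ n) (hk : 3 ≤ k)
    (hnk : 2 ^ (k - 1) ≤ n + 1) :
    IsAdmissible n (fun c => if c ≤ 2 then c else 2 ^ (c - 1) - 1) k := by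
  have hpow : ∀ c, 3 ≤ c → 2 ^ (c + 1 - 1) = 2 * 2 ^ (c - 1) := fun c hc => by
    rw [← pow_succ']
    congr 1
    omega
  have hlow : ∀ c, 3 ≤ c → 4 ≤ 2 ^ (c - 1) := fun c hc =>
    (show 4 = 2 ^ 2 by norm_num).trans_le (Nat.pow_le_pow_right (by norm_num) (by omega))
  refine ⟨hn, hk, strictMono_nat_of_lt_succ fun c => ?_, fun c hc => ?_, fun c hc => ?_, fun h4 => ?_⟩
  · split_ifs with h1 h2
    · omega
    · obtain rfl : c = 2 := by omega
      norm_num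
    · omega
    · have := hpow c (by omega)
      have := hlow c (by omega)
      omega
  · interval_cases c <;> rfl
  · rw [if_neg (by omega), if_neg (by omega), hpow c hc]
    omega
  · have h1 := hpow (k - 1) (by omega)
    have h2 := hlow (k - 1) (by omega)
    rw [show k - 1 + 1 - 1 = k - 1 by omega] at h1
    rw [if_neg (by omega)]
    omega

/-- The lengths are 1, 1, 1, 3, 6, 12, …, the extremal sequence of `three_mul_two_pow_le`. The last
interval runs to n and needs one vertex more than precede it. -/
theorem isAdmissible_cycleFamily {n k : ℕ} (hn : 3 ≤ n) (hk : 3 ≤ k)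
    (hnk : 4 ≤ k → 3 * 2 ^ (k - 3) + 1 ≤ n) :
    IsAdmissible n (fun c => if c ≤ 2 then c else 3 * 2 ^ (c - 3)) k := by
  have hpow : ∀ c, 3 ≤ c → 2 ^ (c + 1 - 3) = 2 * 2 ^ (c - 3) := fun c hc => by
    rw [← pow_succ']
    congr 1
    omega
  refine ⟨hn, hk, strictMono_nat_of_lt_succ fun c => ?_, fun c hc => ?_, fun c hc => ?_, fun h4 => ?_⟩
  · split_ifs with h1 h2
    · omega
    · obtain rfl : c = 2 := by omega
      norm_num
    · omega
    · have := hpow c (by omega)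
      have : 0 < 2 ^ (c - 3) := by positivity
      omega
  · interval_cases c <;> rfl
  · rw [if_neg (by omega), if_neg (by omega), hpow c hc]
    omega
  · have h1 := hpow (k - 1) (by omega)
    have h2 := hnk h4
    rw [show k - 1 + 1 - 3 = k - 3 by omega] at h1
    rw [if_neg (by omega)]
    omega

theorem polyNumber_eq {V : Type*} {𝓗 : Set (⊤ : SimpleGraph V).Subgraph} {k : ℕ}
    {φ : TopEdgeLabeling V ℕ} (hφ : IsPolychromatic 𝓗 φ) (hk : numColors φ = k)
    (hle : ∀ χ : TopEdgeLabeling V ℕ, IsPolychromatic 𝓗 χ → numColors χ ≤ k) :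
    polyNumber 𝓗 = k :=
  IsGreatest.csSup_eq ⟨⟨φ, hφ, hk⟩, fun _ ⟨χ, hχ, hj⟩ => hj ▸ hle χ hχ⟩

theorem exists_optimal_of {n k : ℕ} {σ : ℕ → ℕ} (h : IsAdmissible n σ k)
    {𝓗 : Set (⊤ : SimpleGraph (Fin n)).Subgraph}
    (hφ : IsPolychromatic 𝓗 (recoloring n σ k)) (hk : polyNumber 𝓗 = k) :
    ∃ φ ψ : TopEdgeLabeling (Fin n) ℕ, IsOptimal 𝓗 φ ∧ IsSimplyOrdered ψ ∧
      IsOneEdgeRecoloring ψ φ ∧ ∃ Z : Finset (Fin n), Z.card = 3 ∧ IsQuasiSimplyOrdered φ Z :=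
  ⟨recoloring n σ k, levelColoring n σ k, ⟨hφ, h.numColors_recoloring.trans hk.symm⟩,
    IsAdmissible.isSimplyOrdered_levelColoring, h.isOneEdgeRecoloring, h.isQuasiSimplyOrdered⟩

theorem twoRegularFamily_spec {n : ℕ} (hn : 3 ≤ n) :
    ∃ σ, IsAdmissible n σ (Nat.log 2 (n + 1) + 1) ∧
      IsPolychromatic (twoRegularFamily (Fin n) 0) (recoloring n σ (Nat.log 2 (n + 1) + 1)) ∧
      polyNumber (twoRegularFamily (Fin n) 0) = Nat.log 2 (n + 1) + 1 := by
  have h2 : 2 ≤ Nat.log 2 (n + 1) := Nat.le_log_of_pow_le (by norm_num) (by omega)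
  have h := isAdmissible_twoRegularFamily hn (k := Nat.log 2 (n + 1) + 1) (by omega)
    (Nat.pow_log_le_self 2 (by omega))
  have hφ := h.isPolychromatic_twoRegularFamily fun c hc => by
    have : 2 ^ (c + 1 - 1) = 2 * 2 ^ (c - 1) := by
      rw [← pow_succ']
      congr 1
      omega
    have : 0 < 2 ^ (c - 1) := by positivity
    rw [if_neg (by omega), if_neg (by omega)]
    omega
  refine ⟨_, h, hφ, polyNumber_eq hφ h.numColors_recoloring fun χ hχ => ?_⟩
  have := two_pow_le_of_isPolychromatic_twoRegularFamily (by simpa using hn) hχ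
  rw [Fintype.card_fin] at this
  have := Nat.le_log_of_pow_le (by norm_num) this
  omega

theorem cycleFamily_optimal_spec {n : ℕ} (hn : 3 ≤ n) :
    ∃ σ, IsAdmissible n σ (Nat.log 2 ((n - 1) / 3) + 3) ∧
      IsPolychromatic (cycleFamily (Fin n) 0) (recoloring n σ (Nat.log 2 ((n - 1) / 3) + 3)) ∧
      polyNumber (cycleFamily (Fin n) 0) = Nat.log 2 ((n - 1) / 3) + 3 := by
  have h := isAdmissible_cycleFamily hn (k := Nat.log 2 ((n - 1) / 3) + 3) (by omega) fun h4 => by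
    -- Four colors require a positive logarithm. For n = 3 the quotient is 0 and the convention
    -- `Nat.log 2 0 = 0` gives the three colors of the triangle.
    have hne : (n - 1) / 3 ≠ 0 := fun h0 => by
      rw [h0, Nat.log_zero_right] at h4
      omega
    have := Nat.pow_log_le_self 2 hne
    rw [Nat.add_sub_cancel]
    omega
  have hφ := h.isPolychromatic_cycleFamily
  refine ⟨_, h, hφ, polyNumber_eq hφ h.numColors_recoloring fun χ hχ => ?_⟩
  by_contra! hlt
  have := card_le_of_isPolychromatic_cycleFamily (by simpa using hn) hχ (by omega)
  rw [Fintype.card_fin] at this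
  have := Nat.le_log_of_pow_le (b := 2) (x := numColors χ - 3) (y := (n - 1) / 3) (by norm_num)
    (by omega)
  omega

theorem floor_logb_succ (n : ℕ) : ⌊Real.logb 2 ((n : ℝ) + 1)⌋ = (Nat.log 2 (n + 1) : ℤ) := by
  have := Real.floor_logb_natCast (b := 2) (r := (n : ℝ) + 1) (by positivity)
  rw [Nat.cast_ofNat] at this
  rw [this, ← Nat.cast_succ, Int.log_natCast]

/-- The factor 8 contributes exactly 3, and (n - 1)/3 ≥ 1 allows rounding down before taking the
logarithm. At n = 3 the two sides would be 2 and 3. -/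
theorem floor_logb_cycle {n : ℕ} (hn : 4 ≤ n) :
    ⌊Real.logb 2 (8 * ((n : ℝ) - 1) / 3)⌋ = (Nat.log 2 ((n - 1) / 3) : ℤ) + 3 := by
  have hn' : (4 : ℝ) ≤ n := by exact_mod_cast hn
  have hx : (1 : ℝ) ≤ ((n - 1 : ℕ) : ℝ) / 3 := by
    rw [Nat.cast_sub (by omega), Nat.cast_one]
    linarith
  have h8 : Real.logb 2 8 = 3 := by
    rw [show (8 : ℝ) = 2 ^ (3 : ℕ) by norm_num, Real.logb_pow, Real.logb_self_eq_one (by norm_num)]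
    norm_num
  have hfl := Real.floor_logb_natCast (b := 2) (r := ((n - 1 : ℕ) : ℝ) / 3) (by linarith)
  rw [Nat.cast_ofNat] at hfl
  have hsplit : Real.logb 2 (8 * ((n : ℝ) - 1) / 3) =
      Real.logb 2 (((n - 1 : ℕ) : ℝ) / 3) + (3 : ℕ) := by
    rw [mul_div_assoc, Real.logb_mul (by norm_num) (by linarith), h8, add_comm,
      Nat.cast_sub (by omega), Nat.cast_one, Nat.cast_ofNat]
  rw [hsplit, Int.floor_add_natCast, hfl, Int.log_of_one_le_right _ hx, Nat.floor_div_ofNat,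
    Nat.floor_natCast]
  rfl

end Polychromatic

theorem theorem2 (n : ℕ) (hn : 3 ≤ n) :
    (∃ φ ψ : SimpleGraph.TopEdgeLabeling (Fin n) ℕ,
      Polychromatic.IsOptimal (Polychromatic.twoRegularFamily (Fin n) 0) φ ∧
      Polychromatic.IsSimplyOrdered ψ ∧ Polychromatic.IsOneEdgeRecoloring ψ φ ∧
      ∃ Z : Finset (Fin n), Z.card = 3 ∧ Polychromatic.IsQuasiSimplyOrdered φ Z) ∧
    (∃ φ ψ : SimpleGraph.TopEdgeLabeling (Fin n) ℕ,
      Polychromatic.IsOptimal (Polychromatic.cycleFamily (Fin n) 0) φ ∧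
      Polychromatic.IsSimplyOrdered ψ ∧ Polychromatic.IsOneEdgeRecoloring ψ φ ∧
      ∃ Z : Finset (Fin n), Z.card = 3 ∧ Polychromatic.IsQuasiSimplyOrdered φ Z) ∧
    (Polychromatic.polyNumber (Polychromatic.twoRegularFamily (Fin n) 0) : ℤ) =
      1 + ⌊Real.logb 2 ((n : ℝ) + 1)⌋ ∧
    (4 ≤ n →
      (Polychromatic.polyNumber (Polychromatic.cycleFamily (Fin n) 0) : ℤ) =
        ⌊Real.logb 2 (8 * ((n : ℝ) - 1) / 3)⌋) := by
  obtain ⟨σ, h1, h2, h3⟩ := Polychromatic.twoRegularFamily_spec hn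
  obtain ⟨τ, h4, h5, h6⟩ := Polychromatic.cycleFamily_optimal_spec hn
  refine ⟨Polychromatic.exists_optimal_of h1 h2 h3, Polychromatic.exists_optimal_of h4 h5 h6, ?_,
    fun hn4 => ?_⟩
  · rw [h3, Polychromatic.floor_logb_succ]
    push_cast
    ring
  · rw [h6, Polychromatic.floor_logb_cycle hn4]
    push_cast
    ring
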